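/- Let $(X,d)$ be a compact metric space with a base point $\bullet\in X$, and let $R>0$ be such that every open ball of $X$ of positive radius less than $R$ is simply connected. For $c\ge 0$ let $\mathcal M_c$ be the set of unordered pairs $\{x,y\}$ of points of $X$ with $d(x,y)=c$ such that $d\colon X\times X\to[0,\infty)$ has a local minimum at $(x,y)$, and let $\mathrm{LocMin}(d)=\{c\ge 0 \mid \mathcal M_c\neq\emptyset\}$. Assume that $\mathrm{LocMin}(d)$ is finite and that $\mathcal M_c$ is finite for every $c>0$. For $r>0$ let $\mathrm{Rips}(X,r)$ be the geometric realization (with the weak topology) of the abstract simplicial complex whose simplices are the non-empty finite subsets of $X$ of diameter less than $r$. Let $A$ be a commutative ring, let $H_1(-)$ denote singular homology with coefficients in $A$, and let $\operatorname{mgs}$ denote the least cardinality of a generating set, of an $A$-module in the case of $H_1$ (for $A=\mathbb Z$: of an abelian group), and of a group in the case of $\pi_1$. For a space $K$ let $\mathrm{MGS}(K)=\sum_j \operatorname{mgs}(\pi_1(K_j,x_j))$, where $K_j$ runs through the path components of $K$ and $x_j\in K_j$. Then for every $r>0$: $$\operatorname{mgs}(H_1(\mathrm{Rips}(X,r)))\le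 \operatorname{mgs}(H_1(X))+\sum_{0<c<r}|\mathcal M_c|<\infty,$$ $$\mathrm{MGS}(\mathrm{Rips}(X,r))\le \mathrm{MGS}(X)+\sum_{0<c<r}|\mathcal M_c|<\infty,$$ and in particular $$\operatorname{mgs}(\pi_1(\mathrm{Rips}(X,r),\bullet))\le \mathrm{MGS}(X)+\sum_{0<c<r}|\mathcal M_c|<\infty,$$ the sums running over the finitely many $c\in\mathrm{LocMin}(d)$ with $0<c<r$. -/

import Mathlib

universe u v

noncomputable section

namespace RipsMin

section Realization

variable {ι : Type u}

/-- The underlying set of the geometric realization of an abstract simplicial complex `K`: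
the finitely supported families of barycentric coordinates `f : ι →₀ ℝ`, non-negative and with
sum `1`, whose support is a simplex of `K`. -/
def Realization (K : PreAbstractSimplicialComplex ι) : Type u :=
  {f : ι →₀ ℝ // f.support ∈ K.faces ∧ (∀ i, 0 ≤ f i) ∧ (f.sum fun _ a => a) = 1}

/-- The family of barycentric coordinates of a point of a closed simplex `s`,
extended by zero outside `s`. -/
def extendCoord (s : Finset ι) (g : s → ℝ) : ι →₀ ℝ :=
  Finsupp.embDomain (Function.Embedding.subtype (· ∈ s)) (Finsupp.equivFunOnFinite.symm g)

theorem extendCoord_sum (s : Finset ι) (g : s → ℝ) :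
    ((extendCoord s g).sum fun _ a => a) = ∑ i, g i := by
  classical
  rw [extendCoord, Finsupp.sum_embDomain, Finsupp.sum_fintype _ _ (fun _ => rfl)]
  simp

theorem extendCoord_support_subset (s : Finset ι) (g : s → ℝ) :
    (extendCoord s g).support ⊆ s := by
  intro i hi
  rw [extendCoord, Finsupp.support_embDomain, Finset.mem_map] at hi
  obtain ⟨a, _, rfl⟩ := hi
  exact a.2

theorem extendCoord_nonneg (s : Finset ι) (g : s → ℝ) (hg : ∀ i, 0 ≤ g i) (i : ι) :
    0 ≤ extendCoord s g i := by
  by_cases hi : i ∈ s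
  · have h : extendCoord s g ((Function.Embedding.subtype (· ∈ s)) ⟨i, hi⟩) = g ⟨i, hi⟩ := by
      rw [extendCoord, Finsupp.embDomain_apply_self]
      rfl
    exact h.symm ▸ hg ⟨i, hi⟩
  · have h : i ∉ (extendCoord s g).support := fun h => hi (extendCoord_support_subset s g h)
    rw [Finsupp.notMem_support_iff] at h
    exact h.ge

/-- The inclusion into the realization of `K` of the closed simplex spanned by a face `s`. -/
def simplexMap (K : PreAbstractSimplicialComplex ι) (s : K.faces) (g : stdSimplex ℝ (s : Finset ι)) :
    Realization K :=
  ⟨extendCoord s g, by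
    have hsum : ((extendCoord (s : Finset ι) g).sum fun _ a => a) = 1 := by
      rw [extendCoord_sum]
      exact g.2.2
    refine ⟨(K.isRelLowerSet_faces s.2).2 (extendCoord_support_subset _ _) ?_,
      extendCoord_nonneg _ _ g.2.1, hsum⟩
    by_contra h
    rw [Finset.not_nonempty_iff_eq_empty] at h
    simp [Finsupp.sum, h] at hsum⟩

/-- The weak (coherent) topology on the realization of `K`: a set is open if and only if its
preimage in every closed simplex is open. -/
instance (K : PreAbstractSimplicialComplex ι) : TopologicalSpace (Realization K) :=
  ⨆ s : K.faces, TopologicalSpace.coinduced (simplexMap K s) inferInstance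

/-- The point of the realization given by a vertex `x` of `K`. -/
def vertex (K : PreAbstractSimplicialComplex ι) (x : ι) (hx : {x} ∈ K.faces) : Realization K :=
  ⟨Finsupp.single x 1, by
    refine ⟨?_, fun i => ?_, by simp⟩
    · rwa [Finsupp.support_single _ one_ne_zero]
    · classical
      rw [Finsupp.single_apply]
      split_ifs <;> simp⟩

end Realization

section Rips

variable (X : Type u) [MetricSpace X]

/-- The open Rips complex: its simplices are the non-empty finite subsets of `X` of diameter
less than `r`. -/
def Rips (r : ℝ) : PreAbstractSimplicialComplex X where
  faces := {s | s.Nonempty ∧ Metric.diam (s : Set X) < r}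
  isRelLowerSet_faces := fun s hs => ⟨hs.1, fun _ hts ht =>
    ⟨ht, (Metric.diam_mono (Finset.coe_subset.2 hts) s.finite_toSet.isBounded).trans_lt hs.2⟩⟩

theorem singleton_mem_rips {r : ℝ} (hr : 0 < r) (x : X) : {x} ∈ (Rips X r).faces :=
  ⟨Finset.singleton_nonempty x, by simpa using hr⟩

/-- The geometric realization of the open Rips complex. -/
abbrev RipsSpace (r : ℝ) : Type u := Realization (Rips X r)

/-- The point of the realized Rips complex given by a point of `X`. -/
def ripsPoint {r : ℝ} (hr : 0 < r) (x : X) : RipsSpace X r :=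
  vertex (Rips X r) x (singleton_mem_rips X hr x)

/-- The pairs `(x, y)` with `d(x, y) = c` at which the distance function `d : X × X → ℝ` has a
local minimum. -/
def minPairs (c : ℝ) : Set (X × X) :=
  {p | dist p.1 p.2 = c ∧ IsLocalMin (fun q : X × X => dist q.1 q.2) p}

/-- The same pairs as unordered pairs, that is, as the edges `⟨x, y⟩` which they span. -/
def minEdges (c : ℝ) : Set (Sym2 X) :=
  (fun p : X × X => s(p.1, p.2)) '' minPairs X c

/-- The set of local minima (i.e. local minimum values) of the distance function. -/
def LocMin : Set ℝ := {c | (minPairs X c).Nonempty}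

/-- The total number of edges at which the distance function has a local minimum with value in the
open interval `(0, r)`. The value `0` is left out, its local minima being the points `(x, x)`. -/
def numMinEdges (hmin : (LocMin X).Finite) (r : ℝ) : ℕ∞ :=
  ∑ c ∈ hmin.toFinset with 0 < c ∧ c < r, (minEdges X c).encard

/-- All open balls of positive radius less than `R` are simply connected. -/
def SimplyConnectedUpTo (R : ℝ) : Prop :=
  ∀ (x : X) (r : ℝ), 0 < r → r < R → IsSimplyConnected (Metric.ball x r)

end Rips

section Invariants

/-- The least cardinality of a generating set of a group (`⊤` if it is not finitely generated). -/
def mgs (G : Type u) [Group G] : ℕ∞ :=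
  ⨅ (S : Set G) (_ : Subgroup.closure S = ⊤), S.encard

/-- The least cardinality of a generating set of a module (`⊤` if it is not finitely generated).
Over `ℤ` this is the least cardinality of a generating set of the underlying abelian group. -/
def mgsModule (A : Type v) [CommRing A] (M : Type u) [AddCommGroup M] [Module A M] : ℕ∞ :=
  ⨅ (S : Set M) (_ : Submodule.span A S = ⊤), S.encard

/-- The first singular homology module of a space, with coefficients in a commutative ring. -/
abbrev H1 (A : Type v) [CommRing A] (Y : Type u) [TopologicalSpace Y] : ModuleCat.{max u v} A :=
  ((AlgebraicTopology.singularHomologyFunctor (ModuleCat.{max u v} A) 1).obj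
    (ModuleCat.of A (ULift.{u} A))).obj (TopCat.of Y)

/-- The sum over the path components of `Y` of the least numbers of generators of their
fundamental groups, each taken at a base point chosen in the component (its choice does not matter). -/
def MGS (Y : Type u) [TopologicalSpace Y] : ℕ∞ :=
  ∑' j : ZerothHomotopy Y, mgs (FundamentalGroup Y (Quotient.out j))

end Invariants

end RipsMin

end

/-! Open stars of vertices contract along straight lines, so every path between vertices of the Rips
complex is homotopic to an edge path, and only the edges matter. A partition of unity gives a
continuous map φ from X to the Rips complex for which the vertices of φ(x) are within r/4 of x.
Joining each vertex x to φ(x) by a segment carries paths of X to paths between vertices. An edge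
between two close points is such a pushed path (`FineMap.edge_eq_push`), because small balls are
path connected.

Take a family of path classes closed under concatenation and reversal that contains the pushed paths
and the edges at which d has a positive local minimum. It contains all edges (`FineMap.mem_edge`).
Indeed, moving the end points of an edge slightly does not affect membership: the quadrilateral is
made of two triangles of the complex, and its short sides belong to the family. If some edge were
missing, compactness would give a pair m at which d is least on the closure of the missing pairs.
Then m and all nearby pairs are missing, so d has a local minimum at m. Its value is positive
because short edges belong to the family, a contradiction.

For the bounds, this is applied to the classes which fall into a given subgroup of the fundamental
group once their end points are joined to the base point (`Generates.eq_top`), and to the analogous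
family of 1-chains modulo boundaries (`Generates.span_eq_top`). Generators coming from X account for
the pushed paths, and each minimal edge costs one more generator. Finiteness comes from a finite net
in X: simple connectivity of small balls leaves at most one class of short paths between two net
points (`exists_finite_generates`). -/

noncomputable section

namespace RipsMin

open Set Topology unitInterval

/-! ### Families of path classes and open covers -/

section PathFamilies

variable {Y : Type*} [TopologicalSpace Y]

/-- A set of homotopy classes of paths closed under concatenation and reversal. -/
structure PathFamily (Y : Type*) [TopologicalSpace Y] where
  /-- Membership of a class of paths. -/
  Mem : ∀ {a b : Y}, Path.Homotopic.Quotient a b → Prop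
  trans_mem : ∀ {a b c : Y} {p : Path.Homotopic.Quotient a b} {q : Path.Homotopic.Quotient b c},
    Mem p → Mem q → Mem (p.trans q)
  symm_mem : ∀ {a b : Y} {p : Path.Homotopic.Quotient a b}, Mem p → Mem p.symm

theorem quotient_cast_conj {a b a' b' : Y} (γ : Path a b) (ha : a' = a) (hb : b' = b) :
    ((Path.Homotopic.Quotient.mk ((Path.refl a).cast rfl ha)).trans
      (Path.Homotopic.Quotient.mk (γ.cast ha hb))).trans
        (Path.Homotopic.Quotient.mk ((Path.refl b).cast hb rfl)) =
      Path.Homotopic.Quotient.mk γ := by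
  subst ha hb
  simp

/-- A family of classes of paths contains all classes between the base points `y i` of the members
`U i` of an open cover as soon as it contains those which run first inside one member and then
inside another one. -/
theorem PathFamily.mem_of_openCover (S : PathFamily Y) {J : Type*} (U : J → Set Y)
    (hU : ∀ i, IsOpen (U i)) (hcov : ∀ p, ∃ i, p ∈ U i) (y : J → Y) (hyU : ∀ i, y i ∈ U i)
    (hy : ∀ i, ∀ p ∈ U i, JoinedIn (U i) (y i) p)
    (hS : ∀ i j p (α : Path (y i) p) (β : Path p (y j)), (∀ t, α t ∈ U i) → (∀ t, β t ∈ U j) →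
      S.Mem ((Path.Homotopic.Quotient.mk α).trans (Path.Homotopic.Quotient.mk β)))
    (i j : J) (γ : Path.Homotopic.Quotient (y i) (y j)) : S.Mem γ := by
  induction γ using Path.Homotopic.Quotient.ind with | mk γ =>
  obtain ⟨t, ht0, htm, ⟨N, hN⟩, ht⟩ := exists_monotone_Icc_subset_open_cover_unitInterval
    (c := fun i => γ ⁻¹' U i) (fun i => (hU i).preimage γ.continuous)
    (fun s _ => mem_iUnion.2 (hcov (γ s)))
  let α₀ : Path (y i) (γ 0) := (Path.refl (y i)).cast rfl γ.source
  -- The claim is made for every way `β` of leaving `γ` at time `s` to a base point, so that the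
  -- induction step may choose its own exit.
  let P : I → Prop := fun s => ∀ (k : J) (β : Path (γ s) (y k)), (∀ t, β t ∈ U k) →
    S.Mem (((Path.Homotopic.Quotient.mk α₀).trans
      (Path.Homotopic.Quotient.mk (γ.subpath 0 s))).trans (Path.Homotopic.Quotient.mk β))
  have key : ∀ n, P (t n) := by
    intro n
    induction n with
    | zero =>
      rw [ht0]
      intro k β hβ
      have := hS i k _ α₀ β (fun t => by simpa [α₀] using hyU i) hβ
      simpa using this
    | succ n ih =>
      intro k β hβ
      obtain ⟨l, hl⟩ := ht n
      have hmono := htm (Nat.le_succ n)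
      have h1 : γ (t n) ∈ U l := hl ⟨le_rfl, hmono⟩
      -- Insert a detour to `y l` and back at time `t n`. The part after the detour runs first in `U
      -- l` and then in `U k`, so `hS` applies to it.
      let a := (hy l _ h1).somePath
      have ha : ∀ s, a s ∈ U l := (hy l _ h1).somePath_mem
      have hA := ih l a.symm (fun s => by simpa using ha (σ s))
      have hB := hS l k _ (a.trans (γ.subpath (t n) (t (n + 1)))) β (fun s => by
        have : a.trans (γ.subpath (t n) (t (n + 1))) s ∈
          range a ∪ range (γ.subpath (t n) (t (n + 1))) := by
          rw [← Path.trans_range]; exact mem_range_self s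
        rcases this with ⟨s', hs'⟩ | h
        · rw [← hs']; exact ha s'
        · rw [Path.range_subpath_of_le _ _ _ hmono] at h
          obtain ⟨s', hs', he⟩ := h
          rw [← he]; exact hl hs') hβ
      have hC := S.trans_mem hA hB
      have hsub : (Path.Homotopic.Quotient.mk (γ.subpath 0 (t n))).trans
          (Path.Homotopic.Quotient.mk (γ.subpath (t n) (t (n + 1)))) =
          Path.Homotopic.Quotient.mk (γ.subpath 0 (t (n + 1))) := by
        rw [← Path.Homotopic.Quotient.mk_trans]
        exact Path.Homotopic.Quotient.eq.2 ⟨Path.Homotopy.subpathTransSubpath γ _ _ _⟩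
      rw [← hsub]
      convert hC using 1
      simp only [Path.Homotopic.Quotient.mk_trans, Path.Homotopic.Quotient.mk_symm,
        Path.Homotopic.Quotient.trans_assoc]
      congr 2
      rw [← Path.Homotopic.Quotient.trans_assoc, Path.Homotopic.Quotient.symm_trans,
        Path.Homotopic.Quotient.refl_trans]
  have h1 := key N
  rw [hN N le_rfl] at h1
  have h2 := h1 j ((Path.refl (y j)).cast γ.target rfl) (fun s => by simpa using hyU j)
  rw [Path.subpath_zero_one] at h2
  rwa [quotient_cast_conj γ γ.source γ.target] at h2

end PathFamilies

/-! ### Homotopies from squares -/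

section Squares

variable {Y : Type*} [TopologicalSpace Y]

/-- The two ways around the boundary of a continuous square are homotopic. -/
theorem quotient_square {a b c d : Y} (H : C(I × I, Y)) (p : Path a b) (q : Path c d)
    (l : Path a c) (r : Path b d) (hp : ∀ t, H (t, 0) = p t) (hq : ∀ t, H (t, 1) = q t)
    (hl : ∀ s, H (0, s) = l s) (hr : ∀ s, H (1, s) = r s) :
    (Path.Homotopic.Quotient.mk p).trans (Path.Homotopic.Quotient.mk r) =
      (Path.Homotopic.Quotient.mk l).trans (Path.Homotopic.Quotient.mk q) := by
  obtain rfl : H (0, 0) = a := by simp [hp]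
  obtain rfl : H (1, 0) = b := by simp [hp]
  obtain rfl : H (0, 1) = c := by simp [hq]
  obtain rfl : H (1, 1) = d := by simp [hq]
  -- The four sides are lifted to `I × I`, where the two ways around are homotopic by simple
  -- connectivity; `H` carries the homotopy to `Y`.
  let p' : Path ((0, 0) : I × I) (1, 0) := ⟨⟨fun t => (t, 0), by fun_prop⟩, rfl, rfl⟩
  let q' : Path ((0, 1) : I × I) (1, 1) := ⟨⟨fun t => (t, 1), by fun_prop⟩, rfl, rfl⟩
  let l' : Path ((0, 0) : I × I) (0, 1) := ⟨⟨fun t => (0, t), by fun_prop⟩, rfl, rfl⟩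
  let r' : Path ((1, 0) : I × I) (1, 1) := ⟨⟨fun t => (1, t), by fun_prop⟩, rfl, rfl⟩
  have e1 : p = p'.map H.continuous := by ext t; simp [← hp, p']
  have e2 : q = q'.map H.continuous := by ext t; simp [← hq, q']
  have e3 : l = l'.map H.continuous := by ext t; simp [← hl, l']
  have e4 : r = r'.map H.continuous := by ext t; simp [← hr, r']
  have : SimplyConnectedSpace (I × I) := by
    have : ContractibleSpace I := (convex_Icc (0 : ℝ) 1).contractibleSpace ⟨0, by simp⟩
    infer_instance
  have h := (SimplyConnectedSpace.paths_homotopic (p'.trans r') (l'.trans q')).map H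
  rw [← Path.Homotopic.Quotient.mk_trans, ← Path.Homotopic.Quotient.mk_trans, e1, e2, e3, e4,
    Path.Homotopic.Quotient.eq, ← Path.map_trans, ← Path.map_trans]
  exact h

end Squares

end RipsMin

end

noncomputable section

namespace RipsMin

open Set Topology unitInterval

/-! ### The weak topology and straight paths -/

section RealizationTopology

variable {ι : Type u} {K : PreAbstractSimplicialComplex ι}

theorem extendCoord_apply (s : Finset ι) (g : s → ℝ) (i : ι) (hi : i ∈ s) :
    extendCoord s g i = g ⟨i, hi⟩ := by
  have h : extendCoord s g ((Function.Embedding.subtype (· ∈ s)) ⟨i, hi⟩) = g ⟨i, hi⟩ := by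
    rw [extendCoord, Finsupp.embDomain_apply_self]
    rfl
  exact h

theorem continuous_simplexMap (s : K.faces) : Continuous (simplexMap K s) :=
  continuous_iff_coinduced_le.2 (le_iSup (fun s : K.faces =>
    TopologicalSpace.coinduced (simplexMap K s) inferInstance) s)

theorem Realization.sum_eq_one (p : Realization K) {T : Finset ι} (hT : p.1.support ⊆ T) :
    ∑ i ∈ T, p.1 i = 1 := by
  have h := p.2.2.2
  rw [Finsupp.sum] at h
  exact (Finset.sum_subset hT (fun i _ hi => by simpa using hi)).symm.trans h

theorem continuous_extendCoord (s : Finset ι) (i : ι) :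
    Continuous fun g : s → ℝ => extendCoord s g i := by
  by_cases hi : i ∈ s
  · simp_rw [extendCoord_apply s _ i hi]
    fun_prop
  · have : ∀ g : s → ℝ, extendCoord s g i = 0 := fun g =>
      Finsupp.notMem_support_iff.1 (fun h => hi (extendCoord_support_subset s g h))
    simp_rw [this]
    fun_prop

/-- The barycentric coordinates are continuous for the weak topology. -/
theorem continuous_coord (i : ι) : Continuous fun p : Realization K => p.1 i := by
  rw [continuous_iSup_dom]
  intro s
  rw [continuous_coinduced_dom]
  exact (continuous_extendCoord (s : Finset ι) i).comp continuous_subtype_val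

/-- The point of the closed simplex `s` with the same coordinates as `p`. -/
def Realization.coords (p : Realization K) (s : Finset ι) (hs : p.1.support ⊆ s) :
    stdSimplex ℝ s :=
  ⟨fun i => p.1 i, fun i => p.2.2.1 i, by
    rw [Finset.sum_coe_sort s (fun i => p.1 i)]
    exact p.sum_eq_one hs⟩

theorem simplexMap_coords (p : Realization K) (s : K.faces) (hs : p.1.support ⊆ s) :
    simplexMap K s (p.coords s hs) = p := by
  refine Subtype.ext (Finsupp.ext fun i => ?_)
  by_cases hi : i ∈ (s : Finset ι)
  · exact extendCoord_apply (s : Finset ι) _ i hi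
  · have h1 : p.1 i = 0 := Finsupp.notMem_support_iff.1 (fun h => hi (hs h))
    rw [h1]
    exact Finsupp.notMem_support_iff.1 (fun h => hi (extendCoord_support_subset _ _ h))

/-- A map into the realization which involves only finitely many vertices is continuous if its
barycentric coordinates are. -/
theorem continuous_of_coord {Z : Type*} [TopologicalSpace Z] (F : Z → Realization K)
    (T : Finset ι) (hT : ∀ z, (F z).1.support ⊆ T) (hF : ∀ i, Continuous fun z => (F z).1 i) :
    Continuous F := by
  classical
  let J := {s : K.faces // (s : Finset ι) ⊆ T}
  have hJ : Finite J := by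
    refine Finite.of_injective (fun s : J => (⟨s.1.1, Finset.mem_powerset.2 s.2⟩ : T.powerset)) ?_
    intro s t h
    exact Subtype.ext (Subtype.ext (Subtype.mk.inj h))
  -- Only finitely many faces lie in `T`. The closed sets where the support lies in a given one form
  -- a finite cover, and on each of them `F` factors through one closed simplex.
  let c : J → Set Z := fun s => {z | (F z).1.support ⊆ s.1.1}
  have hc : ∀ s, IsClosed (c s) := by
    intro s
    have : c s = ⋂ i ∈ {i | i ∉ s.1.1}, {z | (F z).1 i = 0} := by
      ext z
      simp only [c, mem_ofPred_eq, mem_iInter]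
      constructor
      · intro h i hi
        exact Finsupp.notMem_support_iff.1 (fun h' => hi (h h'))
      · intro h i hi
        by_contra hne
        exact Finsupp.mem_support_iff.1 hi (h i hne)
    rw [this]
    exact isClosed_biInter (fun i _ => isClosed_eq (hF i) continuous_const)
  refine (locallyFinite_of_finite c).continuous ?_ hc ?_
  · refine eq_univ_of_forall (fun z => mem_iUnion.2 ⟨⟨⟨_, (F z).2.1⟩, hT z⟩, ?_⟩)
    exact Finset.Subset.refl _
  · intro s
    rw [continuousOn_iff_continuous_domRestrict]
    have : (c s).domRestrict F = fun z : c s => simplexMap K s.1 ((F z).coords s.1.1 z.2) := by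
      funext z
      exact (simplexMap_coords _ _ _).symm
    change Continuous ((c s).domRestrict F)
    rw [this]
    refine (continuous_simplexMap s.1).comp ?_
    refine Continuous.subtype_mk (continuous_pi fun i => ?_) _
    exact (hF _).comp continuous_subtype_val

/-- The convex combination of two points whose supports lie in a common face. -/
def Realization.combo (p q : Realization K)
    (h : ∃ s ∈ K.faces, p.1.support ⊆ s ∧ q.1.support ⊆ s) (t : I) : Realization K :=
  ⟨(1 - t : ℝ) • p.1 + (t : ℝ) • q.1, by
    classical
    obtain ⟨s, hs, hp, hq⟩ := h
    have hsub : ((1 - t : ℝ) • p.1 + (t : ℝ) • q.1).support ⊆ s :=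
      Finsupp.support_add.trans (Finset.union_subset (Finsupp.support_smul.trans hp)
        (Finsupp.support_smul.trans hq))
    have hsum : (((1 - t : ℝ) • p.1 + (t : ℝ) • q.1).sum fun _ a => a) = 1 := by
      rw [Finsupp.sum_of_support_subset _ hsub _ (by simp)]
      simp only [Finsupp.add_apply, Finsupp.smul_apply, smul_eq_mul, Finset.sum_add_distrib,
        ← Finset.mul_sum, p.sum_eq_one hp, q.sum_eq_one hq]
      ring
    refine ⟨(K.isRelLowerSet_faces hs).2 hsub ?_, fun i => ?_, hsum⟩
    · by_contra h
      rw [Finset.not_nonempty_iff_eq_empty] at h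
      simp [Finsupp.sum, h] at hsum
    · have h0 := t.2.1
      have h1 := t.2.2
      have := p.2.2.1 i
      have := q.2.2.1 i
      simp only [Finsupp.add_apply, Finsupp.smul_apply, smul_eq_mul]
      have : 0 ≤ 1 - (t : ℝ) := by linarith
      positivity⟩

theorem Realization.combo_apply (p q : Realization K) (h) (t : I) (i : ι) :
    (p.combo q h t).1 i = (1 - t : ℝ) * p.1 i + t * q.1 i := by
  simp [combo]

theorem Realization.combo_support_subset (p q : Realization K) (h) (t : I) {T : Finset ι}
    (hp : p.1.support ⊆ T) (hq : q.1.support ⊆ T) : (p.combo q h t).1.support ⊆ T := by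
  classical
  exact Finsupp.support_add.trans (Finset.union_subset (Finsupp.support_smul.trans hp)
        (Finsupp.support_smul.trans hq))

theorem Realization.ext_apply {p q : Realization K} (h : ∀ i, p.1 i = q.1 i) : p = q :=
  Subtype.ext (Finsupp.ext h)

/-- The straight path between two points whose supports lie in a common face. -/
def Realization.line (p q : Realization K)
    (h : ∃ s ∈ K.faces, p.1.support ⊆ s ∧ q.1.support ⊆ s) : Path p q where
  toFun := p.combo q h
  continuous_toFun := by
    obtain ⟨s, hs, hp, hq⟩ := id h
    refine continuous_of_coord _ s (fun z => p.combo_support_subset q h z hp hq) fun i => ?_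
    simp_rw [Realization.combo_apply]
    fun_prop
  source' := Realization.ext_apply fun i => by simp [Realization.combo_apply]
  target' := Realization.ext_apply fun i => by simp [Realization.combo_apply]

theorem Realization.line_apply (p q : Realization K) (h) (t : I) :
    p.line q h t = p.combo q h t := rfl

/-- Two contiguous paths form a square with the straight paths between their end points. -/
theorem Realization.line_square {a b c d : Realization K} (p : Path a b) (q : Path c d)
    (T : Finset ι) (hT : ∀ t, (p t).1.support ⊆ T ∧ (q t).1.support ⊆ T)
    (h : ∀ t, ∃ s ∈ K.faces, (p t).1.support ⊆ s ∧ (q t).1.support ⊆ s)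
    (hac) (hbd) :
    (Path.Homotopic.Quotient.mk p).trans (Path.Homotopic.Quotient.mk (b.line d hbd)) =
      (Path.Homotopic.Quotient.mk (a.line c hac)).trans (Path.Homotopic.Quotient.mk q) := by
  let F : I × I → Realization K := fun z => (p z.1).combo (q z.1) (h z.1) z.2
  have hF : Continuous F := by
    -- The finite vertex set `T` reduces joint continuity to that of the coordinates.
    refine continuous_of_coord _ T (fun z => combo_support_subset _ _ _ _ (hT z.1).1 (hT z.1).2)
      fun i => ?_
    simp_rw [F, Realization.combo_apply]
    have h1 : Continuous fun z : I × I => (p z.1).1 i :=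
      (continuous_coord (K := K) i).comp (p.continuous.comp continuous_fst)
    have h2 : Continuous fun z : I × I => (q z.1).1 i :=
      (continuous_coord (K := K) i).comp (q.continuous.comp continuous_fst)
    exact ((continuous_const.sub (continuous_subtype_val.comp continuous_snd)).mul h1).add
      ((continuous_subtype_val.comp continuous_snd).mul h2)
  refine quotient_square ⟨F, hF⟩ p q _ _ (fun t => ?_) (fun t => ?_) (fun t => ?_) (fun t => ?_) <;>
  refine Realization.ext_apply fun i => ?_
  · simp [F, combo_apply]
  · simp [F, combo_apply]
  · simp [F, combo_apply, line_apply]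
  · simp [F, combo_apply, line_apply]

theorem Realization.line_self (p : Realization K) (h) : p.line p h = Path.refl p := by
  refine Path.ext (funext fun t => ?_)
  refine Realization.ext_apply fun i => ?_
  rw [line_apply, combo_apply]
  simp only [Path.refl_apply]
  ring

/-- This is the square between the constant path at `a` and the segment from `b` to `c`, all of it
inside the simplex `s`. -/
theorem Realization.line_triangle {s : Finset ι} (hs : s ∈ K.faces) {a b c : Realization K}
    (ha : a.1.support ⊆ s) (hb : b.1.support ⊆ s) (hc : c.1.support ⊆ s) (hab) (hbc) (hac) :
    (Path.Homotopic.Quotient.mk (a.line b hab)).trans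
      (Path.Homotopic.Quotient.mk (b.line c hbc)) =
      Path.Homotopic.Quotient.mk (a.line c hac) := by
  have hs' : ∀ t, (Path.refl a t).1.support ⊆ s ∧ (b.line c hbc t).1.support ⊆ s := fun t =>
    ⟨ha, combo_support_subset b c hbc t hb hc⟩
  have h := line_square (Path.refl a) (b.line c hbc) s hs' (fun t => ⟨s, hs, hs' t⟩) hab hac
  rw [← h, Path.Homotopic.Quotient.mk_refl, Path.Homotopic.Quotient.refl_trans]

theorem Realization.line_symm (a b : Realization K) (hab) (hba) :
    (Path.Homotopic.Quotient.mk (a.line b hab)).symm =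
      Path.Homotopic.Quotient.mk (b.line a hba) := by
  obtain ⟨s, hs, ha, hb⟩ := id hab
  have h := line_triangle hs ha hb ha hab hba ⟨s, hs, ha, ha⟩
  rw [line_self, Path.Homotopic.Quotient.mk_refl] at h
  rw [← Path.Homotopic.Quotient.trans_refl (Path.Homotopic.Quotient.mk (a.line b hab)).symm, ← h,
    ← Path.Homotopic.Quotient.trans_assoc, Path.Homotopic.Quotient.symm_trans,
    Path.Homotopic.Quotient.refl_trans]

end RealizationTopology

/-! ### Open stars and reduction to edge paths -/

section Stars

variable {ι : Type u} {K : PreAbstractSimplicialComplex ι}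

/-- The open star of a vertex. -/
def openStar (K : PreAbstractSimplicialComplex ι) (x : ι) : Set (Realization K) :=
  {p | 0 < p.1 x}

theorem isOpen_openStar (x : ι) : IsOpen (openStar K x) :=
  isOpen_lt continuous_const (continuous_coord x)

theorem exists_mem_openStar (p : Realization K) : ∃ x, p ∈ openStar K x := by
  by_contra! h
  have h0 : ∀ i, p.1 i = 0 := fun i => le_antisymm (not_lt.1 (h i)) (p.2.2.1 i)
  have : p.1 = 0 := Finsupp.ext h0
  have h1 := p.2.2.2
  rw [this] at h1
  simp at h1

theorem singleton_mem_of_mem_openStar {x : ι} {p : Realization K} (h : p ∈ openStar K x) :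
    {x} ∈ K.faces :=
  (K.isRelLowerSet_faces p.2.1).2
    (Finset.singleton_subset_iff.2 (Finsupp.mem_support_iff.2 h.ne')) (Finset.singleton_nonempty x)

theorem support_vertex (x : ι) (hx : {x} ∈ K.faces) : (vertex K x hx).1.support = {x} :=
  Finsupp.support_single x one_ne_zero

theorem exists_face_of_mem_openStar {x : ι} (hx : {x} ∈ K.faces) {p : Realization K}
    (h : p ∈ openStar K x) :
    ∃ s ∈ K.faces, p.1.support ⊆ s ∧ (vertex K x hx).1.support ⊆ s :=
  ⟨_, p.2.1, Finset.Subset.refl _, by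
    rw [support_vertex]
    exact Finset.singleton_subset_iff.2 (Finsupp.mem_support_iff.2 h.ne')⟩

theorem exists_face_of_mem_openStar' {x : ι} (hx : {x} ∈ K.faces) {p : Realization K}
    (h : p ∈ openStar K x) :
    ∃ s ∈ K.faces, (vertex K x hx).1.support ⊆ s ∧ p.1.support ⊆ s :=
  let ⟨s, h1, h2, h3⟩ := exists_face_of_mem_openStar hx h
  ⟨s, h1, h3, h2⟩

/-- An open star may meet infinitely many simplices, so a homotopy on it cannot be checked by
coordinates alone. Through this quotient map it can be checked on one simplex at a time. -/
theorem isQuotientMap_simplexMap :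
    IsQuotientMap (fun z : Σ s : K.faces, stdSimplex ℝ (s : Finset ι) => simplexMap K z.1 z.2) := by
  refine ⟨⟨?_⟩, ?_⟩
  · change _ = TopologicalSpace.coinduced _ (⨆ s, _)
    rw [coinduced_iSup]
    rfl
  · refine fun p => ⟨⟨⟨_, p.2.1⟩, p.coords _ (Finset.Subset.refl _)⟩, simplexMap_coords p ⟨_, p.2.1⟩
      (Finset.Subset.refl _)⟩

/-- The straight line contraction of the open star of a vertex is continuous. -/
theorem continuous_star_contraction (x : ι) (hx : {x} ∈ K.faces) :
    Continuous fun z : openStar K x × I =>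
      (z.1 : Realization K).combo (vertex K x hx) (exists_face_of_mem_openStar hx z.1.2) z.2 := by
  classical
  have hq := (isQuotientMap_simplexMap (K := K)).restrictPreimage_isOpen (isOpen_openStar x)
  -- Since `I` is locally compact, the product of the quotient map with `I` is again a quotient map.
  -- Upstairs each simplex is open and involves only its own vertices and `x`.
  refine hq.continuous_lift_prod_left ?_
  let D := (fun z : Σ s : K.faces, stdSimplex ℝ (s : Finset ι) => simplexMap K z.1 z.2) ⁻¹'
    openStar K x
  let V : K.faces → Set (D × I) := fun s => {w | w.1.1.1 = s}
  have hV : ∀ s, IsOpen (V s) := fun s => by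
    have h1 : Continuous fun w : D × I => (w.1 : Σ s : K.faces, stdSimplex ℝ (s : Finset ι)) :=
      continuous_subtype_val.comp continuous_fst
    have h2 : V s = (fun w : D × I =>
        (w.1 : Σ s : K.faces, stdSimplex ℝ (s : Finset ι))) ⁻¹' (Sigma.fst ⁻¹' {s}) := rfl
    rw [h2]
    refine IsOpen.preimage h1 ?_
    rw [← Set.range_sigmaMk]
    exact isOpen_range_sigmaMk
  refine continuous_iff_continuousAt.2 fun w => ?_
  refine ContinuousOn.continuousAt (s := V w.1.1.1) ?_ ((hV _).mem_nhds rfl)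
  rw [continuousOn_iff_continuous_domRestrict]
  refine continuous_of_coord _ (w.1.1.1.1 ∪ {x}) (fun z => ?_) fun i => ?_
  · apply Realization.combo_support_subset
    · exact exists_face_of_mem_openStar hx z.1.1.2
    · have hz : (z.1.1.1.1 : Finset ι) ⊆ w.1.1.1 := (congrArg Subtype.val z.2).subset
      exact (extendCoord_support_subset _ _).trans (hz.trans Finset.subset_union_left)
    · rw [support_vertex]
      exact Finset.subset_union_right
  · simp only [Set.domRestrict_apply, Realization.combo_apply]
    have h1 : Continuous fun z : V w.1.1.1 => (simplexMap K z.1.1.1.1 z.1.1.1.2).1 i :=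
      (continuous_coord (K := K) i).comp ((isQuotientMap_simplexMap (K := K)).continuous.comp
        (continuous_subtype_val.comp (continuous_fst.comp continuous_subtype_val)))
    have h2 : Continuous fun z : V w.1.1.1 => (z.1.2 : ℝ) :=
      continuous_subtype_val.comp (continuous_snd.comp continuous_subtype_val)
    exact ((continuous_const.sub h2).mul h1).add (h2.mul continuous_const)

/-- A path inside the open star of a vertex is determined by its end points. -/
theorem mk_trans_line_of_mem_openStar {x : ι} (hx : {x} ∈ K.faces) {a b : Realization K}
    (α : Path a b) (hα : ∀ t, α t ∈ openStar K x) (ha) (hb) :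
    (Path.Homotopic.Quotient.mk α).trans
        (Path.Homotopic.Quotient.mk (b.line (vertex K x hx) hb)) =
      Path.Homotopic.Quotient.mk (a.line (vertex K x hx) ha) := by
  have hc : Continuous fun z : I × I => ((⟨α z.1, hα z.1⟩, z.2) : openStar K x × I) := by
    fun_prop
  have h := quotient_square ⟨_, (continuous_star_contraction x hx).comp hc⟩ α
    (Path.refl (vertex K x hx)) (a.line (vertex K x hx) ha) (b.line (vertex K x hx) hb)
    ?_ ?_ ?_ ?_
  · rw [h, Path.Homotopic.Quotient.mk_refl, Path.Homotopic.Quotient.trans_refl]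
  all_goals
    intro t
    refine Realization.ext_apply fun i => ?_
    simp [Realization.combo_apply, Realization.line_apply]

theorem vertex_mem_openStar {x : ι} (hx : {x} ∈ K.faces) : vertex K x hx ∈ openStar K x := by
  change 0 < Finsupp.single x (1 : ℝ) x
  simp

theorem line_vertex_mem_openStar {x : ι} (hx : {x} ∈ K.faces) {p : Realization K}
    (hp : p ∈ openStar K x) (h) (t : I) : (vertex K x hx).line p h t ∈ openStar K x := by
  have h1 : (vertex K x hx).1 x = 1 := by simp [vertex]
  have hp' : 0 < p.1 x := hp
  change 0 < ((vertex K x hx).combo p h t).1 x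
  rw [Realization.combo_apply, h1]
  rcases eq_or_lt_of_le t.2.1 with h0 | h0
  · rw [← h0]; simp
  · have := t.2.2
    have := mul_pos h0 hp'
    linarith

/-- A family of classes of paths in the realization which contains all the edges contains all
classes of paths between vertices. -/
theorem PathFamily.mem_of_edges (S : PathFamily (Realization K))
    (hS : ∀ (x y : ι) (hx : {x} ∈ K.faces) (hy : {y} ∈ K.faces) (h),
      S.Mem (Path.Homotopic.Quotient.mk ((vertex K x hx).line (vertex K y hy) h)))
    {x y : ι} (hx : {x} ∈ K.faces) (hy : {y} ∈ K.faces)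
    (γ : Path.Homotopic.Quotient (vertex K x hx) (vertex K y hy)) : S.Mem γ := by
  let J := {x : ι // {x} ∈ K.faces}
  refine S.mem_of_openCover (fun j : J => openStar K j.1) (fun j => isOpen_openStar j.1) ?_
    (fun j : J => vertex K j.1 j.2) (fun j => vertex_mem_openStar j.2) ?_ ?_ ⟨x, hx⟩ ⟨y, hy⟩ γ
  · intro p
    obtain ⟨x, hx⟩ := exists_mem_openStar p
    exact ⟨⟨x, singleton_mem_of_mem_openStar hx⟩, hx⟩
  · intro j p hp
    exact ⟨(vertex K j.1 j.2).line p (exists_face_of_mem_openStar' j.2 hp),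
      line_vertex_mem_openStar j.2 hp _⟩
  · intro i j p α β hα hβ
    have hpi : p ∈ openStar K i.1 := by simpa using hα 1
    have hpj : p ∈ openStar K j.1 := by simpa using hβ 0
    have hi := exists_face_of_mem_openStar i.2 hpi
    have hi' := exists_face_of_mem_openStar' i.2 hpi
    have hj := exists_face_of_mem_openStar j.2 hpj
    have hjj := exists_face_of_mem_openStar j.2 (vertex_mem_openStar j.2)
    have hii := exists_face_of_mem_openStar i.2 (vertex_mem_openStar i.2)
    -- Both vertices lie in the support of `p`, which is a face. The straight paths to and from `p`
    -- therefore compose to an edge.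
    have hsi : (vertex K i.1 i.2).1.support ⊆ p.1.support := by
      rw [support_vertex]
      exact Finset.singleton_subset_iff.2 (Finsupp.mem_support_iff.2 (ne_of_gt hpi))
    have hsj : (vertex K j.1 j.2).1.support ⊆ p.1.support := by
      rw [support_vertex]
      exact Finset.singleton_subset_iff.2 (Finsupp.mem_support_iff.2 (ne_of_gt hpj))
    have e1 := mk_trans_line_of_mem_openStar i.2 α hα hii hi
    have e2 := mk_trans_line_of_mem_openStar j.2 β hβ hj hjj
    rw [Realization.line_self, Path.Homotopic.Quotient.mk_refl] at e1
    rw [Realization.line_self, Path.Homotopic.Quotient.mk_refl,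
      Path.Homotopic.Quotient.trans_refl] at e2
    have e3 : Path.Homotopic.Quotient.mk α =
        Path.Homotopic.Quotient.mk ((vertex K i.1 i.2).line p hi') := by
      rw [← Realization.line_symm _ _ hi hi']
      rw [← Path.Homotopic.Quotient.refl_trans
        (Path.Homotopic.Quotient.mk (p.line (vertex K i.1 i.2) hi)).symm, ← e1,
        Path.Homotopic.Quotient.trans_assoc, Path.Homotopic.Quotient.trans_symm,
        Path.Homotopic.Quotient.trans_refl]
    rw [e3, e2, Realization.line_triangle p.2.1 hsi (Finset.Subset.refl _) hsj _ _
      ⟨_, p.2.1, hsi, hsj⟩]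
    exact hS _ _ _ _ _

end Stars

end RipsMin

end

noncomputable section

namespace RipsMin

open Set Topology unitInterval

/-! ### Fine maps and the minimum argument -/

section Fine

variable {X : Type u} [MetricSpace X] {r : ℝ}

theorem mem_rips_of_dist_lt {s : Finset X} (hs : s.Nonempty)
    (h : ∀ x ∈ s, ∀ y ∈ s, dist x y < r) : s ∈ (Rips X r).faces := by
  refine ⟨hs, ?_⟩
  obtain ⟨m, hm, hmax⟩ := Finset.exists_max_image (s ×ˢ s) (fun q : X × X => dist q.1 q.2)
    (hs.product hs)
  rw [Finset.mem_product] at hm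
  refine lt_of_le_of_lt (Metric.diam_le_of_forall_dist_le dist_nonneg fun x hx y hy => ?_)
    (h m.1 hm.1 m.2 hm.2)
  exact hmax (x, y) (Finset.mem_product.2 ⟨hx, hy⟩)

theorem mem_rips_of_subset_ball {s : Finset X} (hs : s.Nonempty) (z : X)
    (h : ∀ x ∈ s, dist z x < r / 2) : s ∈ (Rips X r).faces := by
  refine mem_rips_of_dist_lt hs fun x hx y hy => ?_
  have h1 := h x hx
  have h2 := h y hy
  have := dist_triangle x z y
  rw [dist_comm x z] at this
  linarith

theorem exists_rips_face {p q : RipsSpace X r} (z : X)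
    (hp : ∀ x ∈ p.1.support, dist z x < r / 2) (hq : ∀ x ∈ q.1.support, dist z x < r / 2) :
    ∃ s ∈ (Rips X r).faces, p.1.support ⊆ s ∧ q.1.support ⊆ s := by
  classical
  refine ⟨p.1.support ∪ q.1.support, mem_rips_of_subset_ball ?_ z ?_, Finset.subset_union_left,
    Finset.subset_union_right⟩
  · exact p.2.1.1.mono Finset.subset_union_left
  · intro x hx
    rcases Finset.mem_union.1 hx with hx | hx
    exacts [hp x hx, hq x hx]

theorem support_ripsPoint (hr : 0 < r) (x : X) : (ripsPoint X hr x).1.support = {x} :=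
  support_vertex _ _

theorem exists_edge_face (hr : 0 < r) {x y : X} (h : dist x y < r) :
    ∃ s ∈ (Rips X r).faces, (ripsPoint X hr x).1.support ⊆ s ∧
      (ripsPoint X hr y).1.support ⊆ s := by
  classical
  refine ⟨{x, y}, mem_rips_of_dist_lt (by simp) ?_, ?_, ?_⟩
  · intro a ha b hb
    have h0 : ∀ w : X, dist w w < r := fun w => by simpa using hr
    simp only [Finset.mem_insert, Finset.mem_singleton] at ha hb
    rcases ha with rfl | rfl <;> rcases hb with rfl | rfl <;>
      first
        | exact h0 _
        | assumption
        | (rw [dist_comm]; assumption)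
  · rw [support_ripsPoint]; simp
  · rw [support_ripsPoint]; simp

/-- The class of the edge between two points of distance less than `r`. -/
def edge (hr : 0 < r) (x y : X) (h : dist x y < r) :
    Path.Homotopic.Quotient (ripsPoint X hr x) (ripsPoint X hr y) :=
  Path.Homotopic.Quotient.mk ((ripsPoint X hr x).line (ripsPoint X hr y) (exists_edge_face hr h))

theorem edge_trans (hr : 0 < r) {x y z : X} (hxy : dist x y < r) (hyz : dist y z < r)
    (hxz : dist x z < r) : (edge hr x y hxy).trans (edge hr y z hyz) = edge hr x z hxz := by
  classical
  refine Realization.line_triangle (s := {x, y, z}) (mem_rips_of_dist_lt (by simp) ?_) ?_ ?_ ?_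
    _ _ _
  · intro a ha b hb
    have h0 : ∀ w : X, dist w w < r := fun w => by simpa using hr
    simp only [Finset.mem_insert, Finset.mem_singleton] at ha hb
    rcases ha with rfl | rfl | rfl <;> rcases hb with rfl | rfl | rfl <;>
      first
        | exact h0 _
        | assumption
        | (rw [dist_comm]; assumption)
  all_goals rw [support_ripsPoint]; simp

theorem edge_symm (hr : 0 < r) {x y : X} (hxy : dist x y < r) (hyx : dist y x < r) :
    (edge hr x y hxy).symm = edge hr y x hyx :=
  Realization.line_symm _ _ _ _

/-- A continuous map into the Rips complex which moves points by less than `r / 4` and involves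
only finitely many vertices. -/
structure FineMap (X : Type u) [MetricSpace X] (r : ℝ) where
  /-- The underlying map. -/
  map : C(X, RipsSpace X r)
  /-- The vertices which are involved. -/
  net : Finset X
  support_subset : ∀ x, (map x).1.support ⊆ net
  dist_lt : ∀ x, ∀ i ∈ (map x).1.support, dist x i < r / 4

/-- A finite `r / 4`-net with weights `max 0 (r / 4 - dist x i)`, normalized to sum 1. The vertices
with positive weight lie within `r / 4` of `x`, so they span a simplex. -/
theorem exists_fineMap [CompactSpace X] (hr : 0 < r) : Nonempty (FineMap X r) := by
  classical
  have hr4 : 0 < r / 4 := by linarith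
  obtain ⟨T, -, hTf, hT⟩ := finite_cover_balls_of_compact (isCompact_univ (X := X)) hr4
  lift T to Finset X using hTf
  let w : X → X → ℝ := fun x i => max 0 (r / 4 - dist x i)
  have hw0 : ∀ x i, 0 ≤ w x i := fun x i => le_max_left _ _
  let W : X → ℝ := fun x => ∑ i ∈ T, w x i
  have hW : ∀ x, 0 < W x := by
    intro x
    obtain ⟨i, hi, hxi⟩ := mem_iUnion₂.1 (hT (mem_univ x))
    refine Finset.sum_pos' (fun i _ => hw0 x i) ⟨i, hi, lt_max_of_lt_right ?_⟩
    have := Metric.mem_ball.1 hxi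
    linarith
  let f : X → X →₀ ℝ := fun x => Finsupp.onFinset T (fun i => if i ∈ T then w x i / W x else 0)
    (fun i h => by by_contra hi; simp [hi] at h)
  have hfa : ∀ x i, f x i = if i ∈ T then w x i / W x else 0 := fun x i => rfl
  have hfs : ∀ x, (f x).support ⊆ T := fun x => Finsupp.support_onFinset_subset
  have hfd : ∀ x, ∀ i ∈ (f x).support, dist x i < r / 4 := by
    intro x i hi
    by_contra hlt
    rw [Finsupp.mem_support_iff, hfa] at hi
    have : w x i = 0 := max_eq_left (by linarith)
    simp [this] at hi
  have hsum : ∀ x, ((f x).sum fun _ a => a) = 1 := by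
    intro x
    rw [Finsupp.sum_of_support_subset _ (hfs x) _ (by simp)]
    have : ∀ i ∈ T, f x i = w x i / W x := fun i hi => by rw [hfa, if_pos hi]
    rw [Finset.sum_congr rfl this, ← Finset.sum_div]
    exact div_self (hW x).ne'
  have hmem : ∀ x, (f x).support ∈ (Rips X r).faces := by
    intro x
    refine mem_rips_of_subset_ball ?_ x fun i hi => (hfd x i hi).trans (by linarith)
    by_contra h
    rw [Finset.not_nonempty_iff_eq_empty] at h
    have := hsum x
    simp [Finsupp.sum, h] at this
  let F : X → RipsSpace X r := fun x => ⟨f x, hmem x, fun i => by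
    rw [hfa]
    split_ifs
    · exact div_nonneg (hw0 x i) (hW x).le
    · exact le_rfl, hsum x⟩
  have hw : ∀ i, Continuous fun x => w x i := fun i => by fun_prop
  have hF : Continuous F := by
    refine continuous_of_coord F T hfs fun i => ?_
    change Continuous fun x => f x i
    simp_rw [hfa]
    split_ifs
    · exact (hw i).div (continuous_finsetSum _ fun i _ => hw i) fun x => (hW x).ne'
    · exact continuous_const
  exact ⟨⟨⟨F, hF⟩, T, hfs, hfd⟩⟩

variable (φ : FineMap X r)

/-- The class of the straight path from the vertex `x` to its image under a fine map. -/
def FineMap.lam (hr : 0 < r) (x : X) :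
    Path.Homotopic.Quotient (ripsPoint X hr x) (φ.map x) :=
  Path.Homotopic.Quotient.mk ((ripsPoint X hr x).line (φ.map x) (exists_rips_face x
    (fun y hy => by
      rw [support_ripsPoint, Finset.mem_singleton] at hy
      simpa [hy] using hr)
    (fun y hy => (φ.dist_lt x y hy).trans (by linarith))))

/-- The class of a path of `X`, carried to the vertices of the Rips complex. -/
def FineMap.push (hr : 0 < r) {x y : X} (p : Path.Homotopic.Quotient x y) :
    Path.Homotopic.Quotient (ripsPoint X hr x) (ripsPoint X hr y) :=
  ((φ.lam hr x).trans (p.map φ.map)).trans (φ.lam hr y).symm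

/-- The points `x`, `y` and all vertices of the `φ (p t)` lie within `r / 4 + r / 4` of `x`. So the
edge and `φ ∘ p` are contiguous, and the straight-line homotopy between them stays in the complex.
-/
theorem FineMap.edge_eq_push (hr : 0 < r) {x y : X} (p : Path x y)
    (hp : ∀ t, dist x (p t) < r / 4) (h : dist x y < r) :
    edge hr x y h = φ.push hr (Path.Homotopic.Quotient.mk p) := by
  classical
  have hy : dist x y < r / 4 := by simpa using hp 1
  have hsup : ∀ t, ∀ z ∈ ((ripsPoint X hr x).line (ripsPoint X hr y)
      (exists_edge_face hr h) t).1.support, z = x ∨ z = y := by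
    intro t z hz
    have hsub : ((ripsPoint X hr x).line (ripsPoint X hr y)
      (exists_edge_face hr h) t).1.support ⊆ ({x, y} : Finset X) := by
      refine Realization.combo_support_subset (ripsPoint X hr x) (ripsPoint X hr y)
        (exists_edge_face hr h) t ?_ ?_
      all_goals rw [support_ripsPoint]; simp
    simpa using hsub hz
  have hd := φ.dist_lt
  have key := Realization.line_square ((ripsPoint X hr x).line (ripsPoint X hr y)
    (exists_edge_face hr h)) (p.map φ.map.continuous) ({x, y} ∪ φ.net) (fun t => ⟨fun z hz => ?_,
      (φ.support_subset (p t)).trans Finset.subset_union_right⟩)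
      (fun t => exists_rips_face x (fun z hz => ?_) (fun z hz => ?_)) (exists_rips_face x
    (fun y hy => by
      rw [support_ripsPoint, Finset.mem_singleton] at hy
      simpa [hy] using hr)
    (fun y hy => (φ.dist_lt x y hy).trans (by linarith))) (exists_rips_face y
    (fun z hz => by
      rw [support_ripsPoint, Finset.mem_singleton] at hz
      simpa [hz] using hr)
    (fun z hz => (φ.dist_lt y z hz).trans (by linarith)))
  · change (edge hr x y h).trans (φ.lam hr y) = (φ.lam hr x).trans
      ((Path.Homotopic.Quotient.mk p).map φ.map) at key
    rw [push, ← key, Path.Homotopic.Quotient.trans_assoc, Path.Homotopic.Quotient.trans_symm,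
      Path.Homotopic.Quotient.trans_refl]
  · have := hsup t z hz
    simp only [Finset.mem_union, Finset.mem_insert, Finset.mem_singleton]
    exact Or.inl this
  · rcases hsup t z hz with rfl | rfl
    · simpa using hr
    · linarith
  · have h1 := φ.dist_lt (p t) z hz
    have h2 := hp t
    have := dist_triangle x (p t) z
    linarith

/-- A family of classes of paths in the Rips complex which contains the classes coming from `X`
and the edges at which the distance function has a positive local minimum contains all edges. -/
theorem FineMap.mem_edge [CompactSpace X] (hr : 0 < r) {R : ℝ} (hR : 0 < R)
    (hX : SimplyConnectedUpTo X R)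
    (S : PathFamily (RipsSpace X r))
    (hpush : ∀ (x y : X) (p : Path.Homotopic.Quotient x y), S.Mem (φ.push hr p))
    (hmin : ∀ (x y : X) (h : dist x y < r), 0 < dist x y → (x, y) ∈ minPairs X (dist x y) →
      S.Mem (edge hr x y h))
    (x y : X) (h : dist x y < r) : S.Mem (edge hr x y h) := by
  -- Below `R` balls are path connected; up to `r / 4` a path in the ball is short enough for
  -- `FineMap.edge_eq_push`.
  obtain ⟨ε, hε0, hεR, hεr⟩ : ∃ ε, 0 < ε ∧ ε < R ∧ ε ≤ r / 4 :=
    ⟨min (R / 2) (r / 4), by positivity, (min_le_left _ _).trans_lt (by linarith),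
      min_le_right _ _⟩
  have hshort : ∀ (x y : X) (h : dist x y < r), dist x y < ε → S.Mem (edge hr x y h) := by
    intro x y h hxy
    have hj := (hX x ε hε0 hεR).isPathConnected.joinedIn x (Metric.mem_ball_self hε0) y
      (by rwa [Metric.mem_ball, dist_comm])
    rw [φ.edge_eq_push hr hj.somePath (fun t => ?_) h]
    · exact hpush _ _ _
    · have := hj.somePath_mem t
      rw [Metric.mem_ball, dist_comm] at this
      linarith
  -- The diagonal from `x'` to `y` splits the quadrilateral into two triangles, whence the condition
  -- `dist x' y < r`.
  have hmove : ∀ (x y x' y' : X) (h : dist x y < r) (h' : dist x' y' < r), dist x x' < ε →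
      dist y y' < ε → dist x' y < r →
      (S.Mem (edge hr x' y' h') ↔ S.Mem (edge hr x y h)) := by
    intro x y x' y' h h' hx hy hxy
    have hx' : dist x x' < r := by linarith
    have hx'' : dist x' x < r := by rwa [dist_comm]
    have hy' : dist y y' < r := by linarith
    have hy'' : dist y' y < r := by rwa [dist_comm]
    constructor
    · intro hm
      rw [← edge_trans hr hx' hxy h, ← edge_trans hr h' hy'' hxy]
      exact S.trans_mem (hshort _ _ _ hx) (S.trans_mem hm (hshort _ _ _ (by rwa [dist_comm])))
    · intro hm
      rw [← edge_trans hr hxy hy' h', ← edge_trans hr hx'' h hxy]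
      exact S.trans_mem (S.trans_mem (hshort _ _ _ (by rwa [dist_comm])) hm) (hshort _ _ _ hy)
  let B : Set (X × X) := {q | ∃ h : dist q.1 q.2 < r, ¬ S.Mem (edge hr q.1 q.2 h)}
  by_contra hbad
  have hB : (x, y) ∈ B := ⟨h, hbad⟩
  -- The set `B` need not be closed, so the minimum is taken over its closure; that `m` is itself
  -- bad is shown below.
  obtain ⟨m, hm, hmle⟩ := (isClosed_closure (s := B)).isCompact.exists_isMinOn
    ⟨_, subset_closure hB⟩ (continuous_dist (α := X)).continuousOn
  have hmr : dist m.1 m.2 < r := (hmle (subset_closure hB)).trans_lt h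
  -- Moving both end points by less than `η` adds less than `2 * η` to the distance, which keeps it
  -- below `r`.
  obtain ⟨η, hη0, hηε, hηr⟩ : ∃ η, 0 < η ∧ η ≤ ε ∧ dist m.1 m.2 + 2 * η ≤ r :=
    ⟨min ε ((r - dist m.1 m.2) / 2), lt_min hε0 (by linarith), min_le_left _ _, by
      have := min_le_right ε ((r - dist m.1 m.2) / 2)
      linarith⟩
  have hnear : ∀ q ∈ Metric.ball m η, ∃ h' : dist q.1 q.2 < r,
      (S.Mem (edge hr q.1 q.2 h') ↔ S.Mem (edge hr m.1 m.2 hmr)) := by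
    intro q hq
    rw [Metric.mem_ball, Prod.dist_eq, max_lt_iff, dist_comm q.1, dist_comm q.2] at hq
    have h1 := dist_triangle q.1 m.1 m.2
    have h2 := dist_triangle q.1 m.2 q.2
    rw [dist_comm q.1 m.1] at h1
    exact ⟨by linarith, hmove _ _ _ _ _ _ (by linarith) (by linarith) (by linarith)⟩
  have hmB : ¬ S.Mem (edge hr m.1 m.2 hmr) := by
    obtain ⟨q, hqB, hq⟩ := Metric.mem_closure_iff.1 hm η hη0
    obtain ⟨h', hiff⟩ := hnear q (by rwa [Metric.mem_ball, dist_comm])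
    obtain ⟨_, hq'⟩ := hqB
    exact fun hc => hq' (hiff.2 hc)
  refine hmB (hmin m.1 m.2 hmr ?_ ⟨rfl, ?_⟩)
  · refine lt_of_not_ge fun h0 => hmB (hshort _ _ _ (by linarith))
  -- All pairs near `m` are as bad as `m`, hence in `B`, so minimality over the closure of `B` is a
  -- local minimum of `dist` on `X × X`.
  · filter_upwards [Metric.ball_mem_nhds m hη0] with q hq
    obtain ⟨h', hiff⟩ := hnear q hq
    exact hmle (subset_closure ⟨h', fun hc => hmB (hiff.1 hc)⟩)

/-- A family of classes of paths in the Rips complex which contains the classes coming from `X`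
and the edges at which the distance function has a positive local minimum contains all classes of
paths between vertices. -/
theorem FineMap.mem_of_push_of_minPairs [CompactSpace X] (hr : 0 < r) {R : ℝ} (hR : 0 < R)
    (hX : SimplyConnectedUpTo X R)
    (S : PathFamily (RipsSpace X r))
    (hpush : ∀ (x y : X) (p : Path.Homotopic.Quotient x y), S.Mem (φ.push hr p))
    (hmin : ∀ (x y : X) (h : dist x y < r), 0 < dist x y → (x, y) ∈ minPairs X (dist x y) →
      S.Mem (edge hr x y h))
    (x y : X) (p : Path.Homotopic.Quotient (ripsPoint X hr x) (ripsPoint X hr y)) : S.Mem p := by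
  classical
  refine S.mem_of_edges (fun x y hx hy h => ?_) _ _ p
  refine φ.mem_edge hr hR hX S hpush hmin x y ?_
  obtain ⟨s, hs, h1, h2⟩ := h
  rw [support_vertex, Finset.singleton_subset_iff] at h1 h2
  exact (Metric.dist_le_diam_of_mem s.finite_toSet.isBounded h1 h2).trans_lt hs.2

end Fine

end RipsMin

end

noncomputable section

namespace RipsMin

open Set Topology unitInterval CategoryTheory Simplicial

/-! ### Paths as singular 1-chains modulo boundaries -/

section Hurewicz

variable (A : Type v) [CommRing A] (Y : Type u) [TopologicalSpace Y]

/-- The singular chain complex of a space with coefficients in `A`. -/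
abbrev singChain : ChainComplex (ModuleCat.{max u v} A) ℕ :=
  (TopCat.toSSet.obj (TopCat.of Y)).chainComplex (ModuleCat.of A (ULift.{u} A))

/-- The singular `1`-chains modulo boundaries. -/
abbrev chainsModBoundaries : ModuleCat.{max u v} A := (singChain A Y).opcycles 1

variable {Y}

/-- The singular chain given by a singular simplex. -/
def simplexChain {n : ℕ} (f : C(stdSimplex ℝ (Fin (n + 1)), Y)) : (singChain A Y).X n :=
  ((TopCat.toSSet.obj (TopCat.of Y)).ιChainComplex (R := ModuleCat.of A (ULift.{u} A))
    ((TopCat.toSSetObjEquiv (TopCat.of Y) (.op ⦋n⦌)).symm f)).hom (ULift.up 1)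

/-- A face of a singular simplex. -/
def face {n : ℕ} (i : Fin (n + 2)) (f : C(stdSimplex ℝ (Fin (n + 2)), Y)) :
    C(stdSimplex ℝ (Fin (n + 1)), Y) :=
  f.comp ⟨stdSimplex.map i.succAbove, stdSimplex.continuous_map _⟩

theorem d_simplexChain {n : ℕ} (f : C(stdSimplex ℝ (Fin (n + 2)), Y)) :
    ((singChain A Y).d (n + 1) n).hom (simplexChain A f) =
      ∑ i : Fin (n + 2), (-1 : ℤ) ^ (i : ℕ) • simplexChain A (face i f) := by
  have h := (TopCat.toSSet.obj (TopCat.of Y)).ιChainComplex_d (R := ModuleCat.of A (ULift.{u} A))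
    ((TopCat.toSSetObjEquiv (TopCat.of Y) (.op ⦋n + 1⦌)).symm f)
  have h2 := congrArg (fun g => g.hom (ULift.up 1)) h
  simp only [ModuleCat.hom_comp, LinearMap.comp_apply, ModuleCat.hom_sum, LinearMap.sum_apply,
    ModuleCat.hom_zsmul, LinearMap.smul_apply] at h2
  exact h2

/-- The linear map on chains given by arbitrary values on the singular simplices. -/
theorem exists_linearMap_simplexChain {n : ℕ} {M : ModuleCat.{max u v} A}
    (t : C(stdSimplex ℝ (Fin (n + 1)), Y) → M) :
    ∃ L : (singChain A Y).X n →ₗ[A] M, ∀ f, L (simplexChain A f) = t f := by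
  let Z := TopCat.toSSet.obj (TopCat.of Y)
  let c : Limits.Cofan (fun _ : Z _⦋n⦌ => ModuleCat.of A (ULift.{u} A)) :=
    Limits.Cofan.mk M fun τ => ModuleCat.ofHom
      ((LinearMap.toSpanSingleton A M (t (TopCat.toSSetObjEquiv (TopCat.of Y) (.op ⦋n⦌) τ))).comp
        (ULift.moduleEquiv (R := A) (M := A)).toLinearMap)
  let L := (Z.isColimitChainComplexXCofan (ModuleCat.of A (ULift.{u} A)) n).desc c
  refine ⟨L.hom, fun f => ?_⟩
  have h := (Z.isColimitChainComplexXCofan (ModuleCat.of A (ULift.{u} A)) n).fac c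
    ⟨(TopCat.toSSetObjEquiv (TopCat.of Y) (.op ⦋n⦌)).symm f⟩
  have h2 := congrArg (fun g => g.hom (ULift.up 1)) h
  refine Eq.trans h2 ?_
  simp [c]

/-- The projection modulo the span vanishes on every summand of the coproduct of chains, hence is
zero. -/
theorem span_simplexChain (n : ℕ) :
    Submodule.span A (range fun f : C(stdSimplex ℝ (Fin (n + 1)), Y) => simplexChain A f) = ⊤ := by
  let Z := TopCat.toSSet.obj (TopCat.of Y)
  set N := Submodule.span A (range fun f : C(stdSimplex ℝ (Fin (n + 1)), Y) => simplexChain A f)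
  have h : ModuleCat.ofHom N.mkQ = 0 := by
    refine SSet.chainComplex_hom_ext fun τ => ?_
    obtain ⟨f, rfl⟩ := (TopCat.toSSetObjEquiv (TopCat.of Y) (.op ⦋n⦌)).symm.surjective τ
    refine ModuleCat.hom_ext (LinearMap.ext fun a => ?_)
    obtain ⟨a⟩ := a
    have ha : (ULift.up a : ULift.{u} A) = a • ULift.up 1 := by
      ext; simp
    rw [ha, map_smul, map_smul]
    congr 1
    simp only [Limits.comp_zero, ModuleCat.hom_zero, LinearMap.zero_apply]
    exact (Submodule.Quotient.mk_eq_zero N).2 (Submodule.subset_span ⟨f, rfl⟩)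
  have h2 := congrArg (fun g => LinearMap.ker g.hom) h
  simpa using h2

/-- The singular `1`-simplex of a path. -/
def pathSimplex {a b : Y} (p : Path a b) : C(stdSimplex ℝ (Fin 2), Y) :=
  p.toContinuousMap.comp ⟨stdSimplexHomeomorphUnitInterval,
    stdSimplexHomeomorphUnitInterval.continuous⟩

/-- The class of a path modulo boundaries. -/
def pathChain {a b : Y} (p : Path a b) : chainsModBoundaries A Y :=
  ((singChain A Y).pOpcycles 1).hom (simplexChain A (pathSimplex p))

/-- The boundary of `f` is `q - s + p`, which vanishes modulo boundaries. -/
theorem pathChain_triangle {a b c : Y} (p : Path a b) (q : Path b c) (s : Path a c)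
    (f : C(stdSimplex ℝ (Fin 3), Y)) (hp : face 2 f = pathSimplex p)
    (hq : face 0 f = pathSimplex q) (hs : face 1 f = pathSimplex s) :
    pathChain A p + pathChain A q = pathChain A s := by
  have h := d_simplexChain A f
  rw [Fin.sum_univ_three, hp, hq, hs] at h
  have h2 := congrArg (fun g => g.hom (simplexChain A f)) ((singChain A Y).d_pOpcycles 2 1)
  simp only [ModuleCat.hom_comp, LinearMap.comp_apply, ModuleCat.hom_zero, LinearMap.zero_apply]
    at h2
  rw [h] at h2
  simp only [Fin.val_zero, pow_zero, one_smul, Fin.val_one, pow_one, neg_smul, Fin.val_two,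
    map_add, map_neg] at h2
  simp only [pathChain]
  simp at h2
  rw [← sub_eq_zero, ← h2]
  abel

theorem stdSimplex_map_apply {m n : ℕ} (g : Fin m → Fin n) (b : stdSimplex ℝ (Fin m)) (j : Fin n) :
    stdSimplex.map g b j = ∑ i, if g i = j then b i else 0 := by
  rw [stdSimplex.map_coe, FunOnFinite.linearMap_apply_apply, Finset.sum_filter]

theorem face_apply {n : ℕ} (i : Fin (n + 2)) (f : C(stdSimplex ℝ (Fin (n + 2)), Y))
    (b : stdSimplex ℝ (Fin (n + 1))) : face i f b = f (stdSimplex.map i.succAbove b) := rfl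

theorem stdSimplex_sum_three (b : stdSimplex ℝ (Fin 3)) : b 0 + b 1 + b 2 = 1 := by
  have := stdSimplex.sum_eq_one b
  rwa [Fin.sum_univ_three] at this

theorem pathSimplex_apply {a b : Y} (p : Path a b) (c : stdSimplex ℝ (Fin 2)) :
    pathSimplex p c = p (stdSimplexHomeomorphUnitInterval c) := rfl

theorem coe_stdSimplexHomeomorphUnitInterval (c : stdSimplex ℝ (Fin 2)) :
    (stdSimplexHomeomorphUnitInterval c : ℝ) = c 1 := rfl

/-- The sum of the barycentric coordinates in a set of indices, as a point of the interval. -/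
def coordSum (T : Finset (Fin 3)) (b : stdSimplex ℝ (Fin 3)) : I :=
  ⟨∑ i ∈ T, b i, Finset.sum_nonneg fun i _ => stdSimplex.zero_le b i, by
    rw [← stdSimplex.sum_eq_one b]
    exact Finset.sum_le_sum_of_subset_of_nonneg (Finset.subset_univ T)
      fun i _ _ => stdSimplex.zero_le b i⟩

theorem continuous_stdSimplex_apply (i : Fin 3) :
    Continuous fun b : stdSimplex ℝ (Fin 3) => b i :=
  (continuous_apply i).comp continuous_subtype_val

theorem continuous_coordSum (T : Finset (Fin 3)) : Continuous (coordSum T) :=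
  Continuous.subtype_mk (continuous_finsetSum T fun i _ => continuous_stdSimplex_apply i) _

theorem stdSimplex_map_succAbove (c : stdSimplex ℝ (Fin 2)) :
    (stdSimplex.map (Fin.succAbove (0 : Fin 3)) c 1 = c 0 ∧
      stdSimplex.map (Fin.succAbove (0 : Fin 3)) c 2 = c 1) ∧
    (stdSimplex.map (Fin.succAbove (1 : Fin 3)) c 1 = 0 ∧
      stdSimplex.map (Fin.succAbove (1 : Fin 3)) c 2 = c 1) ∧
    (stdSimplex.map (Fin.succAbove (2 : Fin 3)) c 1 = c 1 ∧
      stdSimplex.map (Fin.succAbove (2 : Fin 3)) c 2 = 0) := by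
  refine ⟨⟨?_, ?_⟩, ⟨?_, ?_⟩, ⟨?_, ?_⟩⟩ <;>
    rw [stdSimplex_map_apply, Fin.sum_univ_two] <;> simp [Fin.succAbove]

theorem pathChain_refl (a : Y) : pathChain A (Path.refl a) = 0 := by
  have h := pathChain_triangle A (Path.refl a) (Path.refl a) (Path.refl a)
    (ContinuousMap.const _ a) rfl rfl rfl
  simpa using h

/-- The 2-simplex is collapsed affinely onto the interval, its vertices going to `0`, `1 / 2` and
`1`; following with `p.trans q` gives the faces `p`, `q` and `p.trans q`. -/
theorem pathChain_trans {a b c : Y} (p : Path a b) (q : Path b c) :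
    pathChain A (p.trans q) = pathChain A p + pathChain A q := by
  have hI : ∀ b : stdSimplex ℝ (Fin 3), b 1 / 2 + b 2 ∈ I := fun b => by
    have h := stdSimplex_sum_three b
    have h0 := stdSimplex.zero_le b 0
    have h1 := stdSimplex.zero_le b 1
    have h2 := stdSimplex.zero_le b 2
    constructor <;> linarith
  let f : C(stdSimplex ℝ (Fin 3), Y) := ⟨fun b => (p.trans q) ⟨b 1 / 2 + b 2, hI b⟩,
    (p.trans q).continuous.comp (Continuous.subtype_mk
      (((continuous_stdSimplex_apply 1).div_const 2).add (continuous_stdSimplex_apply 2)) _)⟩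
  refine (pathChain_triangle A p q (p.trans q) f ?_ ?_ ?_).symm
  · ext c
    obtain ⟨-, -, h1, h2⟩ := stdSimplex_map_succAbove c
    have hc := stdSimplex.le_one c 1
    rw [face_apply, pathSimplex_apply]
    simp only [f, ContinuousMap.coe_mk, h1, h2]
    rw [Path.trans_apply, dif_pos (by simp; linarith)]
    congr 1
    ext
    simp only [coe_stdSimplexHomeomorphUnitInterval]
    ring
  · ext c
    obtain ⟨⟨h1, h2⟩, -, -⟩ := stdSimplex_map_succAbove c
    have hc := stdSimplex.add_eq_one c
    have hc0 := stdSimplex.zero_le c 1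
    rw [face_apply, pathSimplex_apply]
    simp only [f, ContinuousMap.coe_mk, h1, h2]
    rw [Path.trans_apply]
    split_ifs with h
    · simp only at h
      have hc1 : c 1 = 0 := by linarith
      have e1 : (stdSimplexHomeomorphUnitInterval c) = 0 := Subtype.ext hc1
      rw [e1, q.source]
      convert p.target
      simp only [Set.Icc.coe_one]
      linarith
    · congr 1
      ext
      simp only [coe_stdSimplexHomeomorphUnitInterval]
      linarith
  · ext c
    obtain ⟨-, ⟨h1, h2⟩, -⟩ := stdSimplex_map_succAbove c
    rw [face_apply, pathSimplex_apply]
    simp only [f, ContinuousMap.coe_mk, h1, h2]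
    congr 1
    ext
    simp only [coe_stdSimplexHomeomorphUnitInterval]
    ring

/-- The diagonal cuts the square of the homotopy into two triangles. Each has a constant side, so
`p` and `q` both have the class of the diagonal. -/
theorem pathChain_congr {a b : Y} {p q : Path a b} (h : p.Homotopic q) :
    pathChain A p = pathChain A q := by
  obtain ⟨H⟩ := h
  let diag : Path a b := ⟨⟨fun t => H (t, t), by fun_prop⟩, by simp, by simp⟩
  let f : C(stdSimplex ℝ (Fin 3), Y) := ⟨fun b => H (coordSum {2} b, coordSum {1, 2} b),
    H.continuous.comp ((continuous_coordSum _).prodMk (continuous_coordSum _))⟩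
  let g : C(stdSimplex ℝ (Fin 3), Y) := ⟨fun b => H (coordSum {1, 2} b, coordSum {2} b),
    H.continuous.comp ((continuous_coordSum _).prodMk (continuous_coordSum _))⟩
  have key : ∀ c : stdSimplex ℝ (Fin 2),
      (coordSum {2} (stdSimplex.map (Fin.succAbove (0 : Fin 3)) c) =
        stdSimplexHomeomorphUnitInterval c ∧
      coordSum {1, 2} (stdSimplex.map (Fin.succAbove (0 : Fin 3)) c) = 1) ∧
      (coordSum {2} (stdSimplex.map (Fin.succAbove (1 : Fin 3)) c) =
        stdSimplexHomeomorphUnitInterval c ∧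
      coordSum {1, 2} (stdSimplex.map (Fin.succAbove (1 : Fin 3)) c) =
        stdSimplexHomeomorphUnitInterval c) ∧
      (coordSum {2} (stdSimplex.map (Fin.succAbove (2 : Fin 3)) c) = 0 ∧
      coordSum {1, 2} (stdSimplex.map (Fin.succAbove (2 : Fin 3)) c) =
        stdSimplexHomeomorphUnitInterval c) := by
    intro c
    obtain ⟨⟨h1, h2⟩, ⟨h3, h4⟩, h5, h6⟩ := stdSimplex_map_succAbove c
    have hc := stdSimplex.add_eq_one c
    have h12 : (1 : Fin 3) ≠ 2 := by decide
    refine ⟨⟨?_, ?_⟩, ⟨?_, ?_⟩, ⟨?_, ?_⟩⟩ <;> refine Subtype.ext ?_ <;>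
      simp only [coordSum, Finset.sum_singleton, Finset.sum_pair h12, h1, h2, h3, h4, h5, h6,
        coe_stdSimplexHomeomorphUnitInterval, Set.Icc.coe_one, Set.Icc.coe_zero, hc, add_zero,
        zero_add]
  have e1 := pathChain_triangle A p (Path.refl b) diag f ?_ ?_ ?_
  · have e2 := pathChain_triangle A (Path.refl a) q diag g ?_ ?_ ?_
    · rw [pathChain_refl, add_zero] at e1
      rw [pathChain_refl, zero_add] at e2
      rw [e1, e2]
    all_goals
      ext c
      obtain ⟨⟨h1, h2⟩, ⟨h3, h4⟩, h5, h6⟩ := key c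
      rw [face_apply, pathSimplex_apply]
      simp only [g, ContinuousMap.coe_mk, h1, h2, h3, h4, h5, h6]
      simp [diag]
  all_goals
    ext c
    obtain ⟨⟨h1, h2⟩, ⟨h3, h4⟩, h5, h6⟩ := key c
    rw [face_apply, pathSimplex_apply]
    simp only [f, ContinuousMap.coe_mk, h1, h2, h3, h4, h5, h6]
    simp [diag]

/-- The class modulo boundaries of a homotopy class of paths. -/
def cls {a b : Y} (p : Path.Homotopic.Quotient a b) : chainsModBoundaries A Y :=
  Quotient.lift (pathChain A) (fun _ _ h => pathChain_congr A h) p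

theorem cls_mk {a b : Y} (p : Path a b) :
    cls A (Path.Homotopic.Quotient.mk p) = pathChain A p := rfl

theorem cls_trans {a b c : Y} (p : Path.Homotopic.Quotient a b)
    (q : Path.Homotopic.Quotient b c) : cls A (p.trans q) = cls A p + cls A q := by
  induction p using Path.Homotopic.Quotient.ind with | mk p =>
  induction q using Path.Homotopic.Quotient.ind with | mk q =>
  rw [← Path.Homotopic.Quotient.mk_trans, cls_mk, cls_mk, cls_mk, pathChain_trans]

theorem cls_refl (a : Y) : cls A (Path.Homotopic.Quotient.refl a) = 0 :=
  pathChain_refl A a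

theorem cls_symm {a b : Y} (p : Path.Homotopic.Quotient a b) : cls A p.symm = - cls A p := by
  rw [eq_neg_iff_add_eq_zero, ← cls_trans, Path.Homotopic.Quotient.symm_trans, cls_refl]

/-- The `0`-chain of a point. -/
def pointChain (y : Y) : (singChain A Y).X 0 :=
  simplexChain A (n := 0) (ContinuousMap.const _ y)

variable (Y) in
/-- The boundary map on `1`-chains modulo boundaries. -/
def bdry : chainsModBoundaries A Y →ₗ[A] (singChain A Y).X 0 :=
  ((singChain A Y).fromOpcycles 1 0).hom

theorem bdry_cls {a b : Y} (p : Path.Homotopic.Quotient a b) :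
    bdry A Y (cls A p) = pointChain A b - pointChain A a := by
  induction p using Path.Homotopic.Quotient.ind with | mk p =>
  have h2 := congrArg (fun g => g.hom (simplexChain A (pathSimplex p)))
    ((singChain A Y).p_fromOpcycles 1 0)
  simp only [ModuleCat.hom_comp, LinearMap.comp_apply] at h2
  refine Eq.trans h2 ?_
  rw [d_simplexChain, Fin.sum_univ_two]
  have e0 : face 0 (pathSimplex p) = ContinuousMap.const _ b := by
    ext c
    rw [face_apply, pathSimplex_apply]
    have : stdSimplexHomeomorphUnitInterval (stdSimplex.map (Fin.succAbove 0) c) = 1 := by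
      refine Subtype.ext ?_
      rw [coe_stdSimplexHomeomorphUnitInterval, stdSimplex_map_apply]
      have hc := stdSimplex.sum_eq_one c
      rw [Fin.sum_univ_one] at hc ⊢
      rw [if_pos (by decide), hc]
      rfl
    rw [this]; simp
  have e1 : face 1 (pathSimplex p) = ContinuousMap.const _ a := by
    ext c
    rw [face_apply, pathSimplex_apply]
    have : stdSimplexHomeomorphUnitInterval (stdSimplex.map (Fin.succAbove 1) c) = 0 := by
      refine Subtype.ext ?_
      rw [coe_stdSimplexHomeomorphUnitInterval, stdSimplex_map_apply]
      simp [Fin.succAbove]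
    rw [this]; simp
  rw [e0, e1]
  simp [pointChain, sub_eq_add_neg]

theorem span_cls :
    Submodule.span A {z | ∃ (a b : Y) (p : Path.Homotopic.Quotient a b), z = cls A p} = ⊤ := by
  have hsurj : Function.Surjective ((singChain A Y).pOpcycles 1).hom :=
    (ModuleCat.epi_iff_surjective _).1 inferInstance
  rw [eq_top_iff, ← LinearMap.range_eq_top.2 hsurj, LinearMap.range_eq_map,
    ← span_simplexChain A 1, Submodule.map_span]
  refine Submodule.span_mono ?_
  rintro _ ⟨_, ⟨f, rfl⟩, rfl⟩
  let p : Path (f (stdSimplexHomeomorphUnitInterval.symm 0))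
      (f (stdSimplexHomeomorphUnitInterval.symm 1)) :=
    ⟨⟨fun t => f (stdSimplexHomeomorphUnitInterval.symm t), by fun_prop⟩, rfl, rfl⟩
  refine ⟨_, _, Path.Homotopic.Quotient.mk p, ?_⟩
  rw [cls_mk, pathChain]
  congr 2
  ext c
  simp [pathSimplex_apply, p]

theorem exists_linearMap_pointChain {M : ModuleCat.{max u v} A} (t : Y → M) :
    ∃ L : (singChain A Y).X 0 →ₗ[A] M, ∀ y, L (pointChain A y) = t y := by
  obtain ⟨L, hL⟩ := exists_linearMap_simplexChain A (n := 0) (M := M)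
    (fun f : C(stdSimplex ℝ (Fin (0 + 1)), Y) => t (f default))
  exact ⟨L, fun y => hL _⟩

variable (Y) in
/-- The inclusion of the first homology into the `1`-chains modulo boundaries. -/
def homologyIncl : H1 A Y →ₗ[A] chainsModBoundaries A Y :=
  ((singChain A Y).homologyι 1).hom

theorem homologyIncl_injective : Function.Injective (homologyIncl A Y) :=
  (ModuleCat.mono_iff_injective ((singChain A Y).homologyι 1)).1 inferInstance

theorem exists_homologyIncl_eq {z : chainsModBoundaries A Y} (hz : bdry A Y z = 0) :
    ∃ w, homologyIncl A Y w = z := by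
  have h : (ShortComplex.mk _ _ ((singChain A Y).homologyι_comp_fromOpcycles 1 0)).Exact :=
    ShortComplex.exact_of_f_is_kernel _ ((singChain A Y).homologyIsKernel 1 0 (by simp))
  exact (ShortComplex.moduleCat_exact_iff _).1 h z hz

theorem bdry_homologyIncl (w : H1 A Y) : bdry A Y (homologyIncl A Y w) = 0 := by
  have h := congrArg (fun g => g.hom w) ((singChain A Y).homologyι_comp_fromOpcycles 1 0)
  exact h

/-- A continuous map induces linear maps on first homology and on the classes of paths modulo
boundaries, and these are compatible. -/
theorem exists_homologyMap {X : Type u} [TopologicalSpace X] (φ : C(X, Y)) :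
    ∃ (f : H1 A X →ₗ[A] H1 A Y) (g : chainsModBoundaries A X →ₗ[A] chainsModBoundaries A Y),
      (∀ w, homologyIncl A Y (f w) = g (homologyIncl A X w)) ∧
      ∀ (a b : X) (p : Path.Homotopic.Quotient a b), g (cls A p) = cls A (p.map φ) := by
  let F := SSet.chainComplexMap (TopCat.toSSet.map (TopCat.ofHom φ))
    (ModuleCat.of A (ULift.{u} A))
  refine ⟨(HomologicalComplex.homologyMap F 1).hom, (HomologicalComplex.opcyclesMap F 1).hom,
    fun w => ?_, fun a b p => ?_⟩
  · exact congrArg (fun g => g.hom w) (HomologicalComplex.homologyι_naturality F 1)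
  · induction p using Path.Homotopic.Quotient.ind with | mk p =>
    rw [← Path.Homotopic.Quotient.mk_map, cls_mk, cls_mk, pathChain, pathChain]
    have h1 := congrArg (fun g => g.hom (simplexChain A (pathSimplex p)))
      (HomologicalComplex.p_opcyclesMap F 1)
    simp only [ModuleCat.hom_comp, LinearMap.comp_apply] at h1
    rw [h1]
    congr 1
    have h2 := congrArg (fun g => g.hom (ULift.up 1)) (SSet.ι_chainComplexMap_f _ _
      (f := TopCat.toSSet.map (TopCat.ofHom φ)) (R := ModuleCat.of A (ULift.{u} A)) (n := 1)
      ((TopCat.toSSetObjEquiv (TopCat.of X) (.op ⦋1⦌)).symm (pathSimplex p)))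
    exact h2

end Hurewicz

end RipsMin

end

noncomputable section

namespace RipsMin

open Set Topology

/-! ### Least numbers of generators -/

section Mgs

theorem mgs_le {G : Type*} [Group G] {S : Set G} (hS : Subgroup.closure S = ⊤) :
    mgs G ≤ S.encard :=
  iInf₂_le S hS

theorem exists_encard_eq_mgs (G : Type*) [Group G] :
    ∃ S : Set G, Subgroup.closure S = ⊤ ∧ S.encard = mgs G := by
  have : Nonempty {S : Set G // Subgroup.closure S = ⊤} := ⟨⟨univ, Subgroup.closure_univ⟩⟩
  obtain ⟨S, hS⟩ := ciInf_mem fun S : {S : Set G // Subgroup.closure S = ⊤} => (S : Set G).encard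
  refine ⟨S.1, S.2, hS.trans ?_⟩
  rw [mgs, iInf_subtype']

theorem mgs_le_of_mulEquiv {G H : Type*} [Group G] [Group H] (e : G ≃* H) : mgs H ≤ mgs G := by
  obtain ⟨S, hS, hc⟩ := exists_encard_eq_mgs G
  rw [← hc]
  refine (mgs_le (S := e '' S) ?_).trans (encard_image_le _ _)
  have := MonoidHom.map_closure e.toMonoidHom S
  rw [hS, ← MonoidHom.range_eq_map, MonoidHom.range_eq_top.2 e.surjective] at this
  exact this.symm

theorem mgsModule_le {A : Type*} [CommRing A] {M : Type*} [AddCommGroup M] [Module A M] {S : Set M}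
    (hS : Submodule.span A S = ⊤) : mgsModule A M ≤ S.encard :=
  iInf₂_le S hS

theorem exists_encard_eq_mgsModule (A : Type*) [CommRing A] (M : Type*) [AddCommGroup M]
    [Module A M] : ∃ S : Set M, Submodule.span A S = ⊤ ∧ S.encard = mgsModule A M := by
  have : Nonempty {S : Set M // Submodule.span A S = ⊤} := ⟨⟨univ, Submodule.span_univ⟩⟩
  obtain ⟨S, hS⟩ := ciInf_mem fun S : {S : Set M // Submodule.span A S = ⊤} => (S : Set M).encard
  refine ⟨S.1, S.2, hS.trans ?_⟩
  rw [mgsModule, iInf_subtype']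

theorem mgs_fundamentalGroup_eq {Y : Type*} [TopologicalSpace Y] {a b : Y} (h : Joined a b) :
    mgs (FundamentalGroup Y a) = mgs (FundamentalGroup Y b) :=
  le_antisymm
    (mgs_le_of_mulEquiv (FundamentalGroup.fundamentalGroupMulEquivOfPath h.symm.somePath))
    (mgs_le_of_mulEquiv (FundamentalGroup.fundamentalGroupMulEquivOfPath h.somePath))

end Mgs

/-! ### From generating path classes to generators of groups and modules -/

section Generation

variable {Y : Type u} [TopologicalSpace Y] {J : Type*} {w : J → Y}

theorem joined_of_quotient {a b : Y} (p : Path.Homotopic.Quotient a b) : Joined a b := by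
  induction p using Path.Homotopic.Quotient.ind with | mk p => exact ⟨p⟩

/-- The classes `G i j` of paths between the points `w i` generate all classes of paths between
these points. -/
def Generates (w : J → Y) (G : ∀ i j, Set (Path.Homotopic.Quotient (w i) (w j))) : Prop :=
  ∀ S : PathFamily Y, (∀ i j, ∀ p ∈ G i j, S.Mem p) →
    ∀ i j (p : Path.Homotopic.Quotient (w i) (w j)), S.Mem p

/-- The loop obtained from a path by joining its end points to a base point. -/
def loopOf {ρ a b : Y} (s : Path.Homotopic.Quotient ρ a) (p : Path.Homotopic.Quotient a b)
    (t : Path.Homotopic.Quotient ρ b) : FundamentalGroup Y ρ :=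
  FundamentalGroup.fromPath ((s.trans p).trans t.symm)

/-- The inner `t.symm` and `t` cancel. Multiplication in `FundamentalGroup` puts the later loop on
the left, hence the order of the factors. -/
theorem loopOf_trans {ρ a b c : Y} (s : Path.Homotopic.Quotient ρ a)
    (p : Path.Homotopic.Quotient a b) (t : Path.Homotopic.Quotient ρ b)
    (q : Path.Homotopic.Quotient b c) (x : Path.Homotopic.Quotient ρ c) :
    loopOf s (p.trans q) x = loopOf t q x * loopOf s p t := by
  rw [FundamentalGroup.mul_def]
  change _ = Path.Homotopic.Quotient.trans ((s.trans p).trans t.symm) ((t.trans q).trans x.symm)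
  simp only [loopOf, Path.Homotopic.Quotient.trans_assoc]
  congr 2
  rw [← Path.Homotopic.Quotient.trans_assoc t.symm, Path.Homotopic.Quotient.symm_trans,
    Path.Homotopic.Quotient.refl_trans]

theorem loopOf_refl {ρ a : Y} (s : Path.Homotopic.Quotient ρ a) :
    loopOf s (Path.Homotopic.Quotient.refl a) s = 1 := by
  rw [loopOf, Path.Homotopic.Quotient.trans_refl, Path.Homotopic.Quotient.trans_symm]
  rfl

theorem loopOf_symm {ρ a b : Y} (s : Path.Homotopic.Quotient ρ a)
    (p : Path.Homotopic.Quotient a b) (t : Path.Homotopic.Quotient ρ b) :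
    loopOf t p.symm s = (loopOf s p t)⁻¹ := by
  rw [eq_inv_iff_mul_eq_one, ← loopOf_trans, Path.Homotopic.Quotient.trans_symm, loopOf_refl]

/-- The classes of paths which become elements of a subgroup of the fundamental group when their
end points are joined to the base point in a prescribed way. -/
def conjFamily {ρ : Y} (τ : ∀ a, Joined ρ a → Path.Homotopic.Quotient ρ a)
    (H : Subgroup (FundamentalGroup Y ρ)) : PathFamily Y where
  Mem := fun {a b} p => ∀ (ha : Joined ρ a) (hb : Joined ρ b), loopOf (τ a ha) p (τ b hb) ∈ H
  trans_mem := fun {a b c p q} hp hq ha hc => by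
    have hb := ha.trans (joined_of_quotient p)
    rw [loopOf_trans _ p (τ b hb)]
    exact H.mul_mem (hq hb hc) (hp ha hb)
  symm_mem := fun {a b p} hp hb ha => by
    rw [loopOf_symm]
    exact H.inv_mem (hp ha hb)

/-- A path family lives on all of `Y`, so connecting paths are needed at every point; injectivity of
`w` makes the prescribed ones unambiguous. -/
theorem exists_extension {ρ : Y} (hw : Function.Injective w)
    (τ₀ : ∀ j, Joined ρ (w j) → Path.Homotopic.Quotient ρ (w j)) :
    ∃ τ : ∀ a, Joined ρ a → Path.Homotopic.Quotient ρ a, ∀ j h, τ (w j) h = τ₀ j h := by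
  have key : ∀ a (h : Joined ρ a), ∃ q : Path.Homotopic.Quotient ρ a,
      ∀ j (e : w j = a), HEq q (τ₀ j (e ▸ h)) := by
    intro a h
    by_cases ha : ∃ j, w j = a
    · obtain ⟨j, rfl⟩ := ha
      refine ⟨τ₀ j h, fun j' e => ?_⟩
      obtain rfl := hw e
      rfl
    · exact ⟨Path.Homotopic.Quotient.mk h.somePath, fun j e => (ha ⟨j, e⟩).elim⟩
  choose τ hτ using key
  exact ⟨τ, fun j h => eq_of_heq (hτ (w j) h j rfl)⟩

/-- A subgroup of the fundamental group which contains the loops given by a generating family of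
classes of paths is the whole group. -/
theorem Generates.eq_top {G : ∀ i j, Set (Path.Homotopic.Quotient (w i) (w j))}
    (hG : Generates w G) (hw : Function.Injective w) {ρ : Y}
    (τ₀ : ∀ j, Joined ρ (w j) → Path.Homotopic.Quotient ρ (w j))
    (H : Subgroup (FundamentalGroup Y ρ))
    (hH : ∀ i j (hi : Joined ρ (w i)) (hj : Joined ρ (w j)), ∀ p ∈ G i j,
      loopOf (τ₀ i hi) p (τ₀ j hj) ∈ H)
    {j₀ : J} (hj₀ : Joined ρ (w j₀)) : H = ⊤ := by
  obtain ⟨τ, hτ⟩ := exists_extension hw τ₀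
  have h := hG (conjFamily τ H) (fun i j p hp hi hj => by
    rw [hτ, hτ]
    exact hH i j hi hj p hp)
  refine eq_top_iff.2 fun g _ => ?_
  let g' : Path.Homotopic.Quotient ρ ρ := FundamentalGroup.toPath g
  have h1 := h j₀ j₀ (((τ (w j₀) hj₀).symm.trans g').trans (τ (w j₀) hj₀)) hj₀ hj₀
  have h2 : loopOf (τ (w j₀) hj₀) (((τ (w j₀) hj₀).symm.trans g').trans (τ (w j₀) hj₀))
      (τ (w j₀) hj₀) = g := by
    simp only [loopOf, Path.Homotopic.Quotient.trans_assoc, Path.Homotopic.Quotient.trans_symm,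
      Path.Homotopic.Quotient.trans_refl]
    rw [← Path.Homotopic.Quotient.trans_assoc, Path.Homotopic.Quotient.trans_symm,
      Path.Homotopic.Quotient.refl_trans]
  rwa [h2] at h1

variable (A : Type v) [CommRing A]

/-- The classes of paths which lie in a submodule of the chains modulo boundaries when their end
points are corrected in a prescribed way. -/
def chainFamily (t : Y → chainsModBoundaries A Y) (T : Submodule A (chainsModBoundaries A Y)) :
    PathFamily Y where
  Mem := fun {a b} p => t a + cls A p - t b ∈ T
  trans_mem := fun {a b c p q} hp hq => by
    have h := T.add_mem hp hq
    rw [cls_trans]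
    convert h using 1
    abel
  symm_mem := fun {a b p} hp => by
    have h := T.neg_mem hp
    rw [cls_symm]
    convert h using 1
    abel

/-- A set of homology classes spans the first homology if its span contains the cycles given by a
generating family of classes of paths. -/
theorem Generates.span_eq_top {G : ∀ i j, Set (Path.Homotopic.Quotient (w i) (w j))}
    (hG : Generates w G) (hw : Function.Injective w) (hjoin : ∀ a, ∃ j, Joined (w j) a)
    (t₀ : J → chainsModBoundaries A Y) (W : Set (H1 A Y))
    (hW : ∀ i j, ∀ p ∈ G i j, t₀ i + cls A p - t₀ j ∈
      (Submodule.span A W).map (homologyIncl A Y)) : Submodule.span A W = ⊤ := by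
  set T := (Submodule.span A W).map (homologyIncl A Y) with hT
  -- The value `0` away from the points `w j` is harmless: the conclusion is used only for paths
  -- between these points.
  have h := hG (chainFamily A (Function.extend w t₀ 0) T) (fun i j p hp => by
    change Function.extend w t₀ 0 (w i) + cls A p - Function.extend w t₀ 0 (w j) ∈ T
    rw [hw.extend_apply, hw.extend_apply]
    exact hW i j p hp)
  have h' : ∀ i j (p : Path.Homotopic.Quotient (w i) (w j)), t₀ i + cls A p - t₀ j ∈ T := by
    intro i j p
    have := h i j p
    change Function.extend w t₀ 0 (w i) + cls A p - Function.extend w t₀ 0 (w j) ∈ T at this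
    rwa [hw.extend_apply, hw.extend_apply] at this
  choose ν hν using hjoin
  let ℓ : ∀ a, Path.Homotopic.Quotient (w (ν a)) a := fun a =>
    Path.Homotopic.Quotient.mk (hν a).somePath
  let t : Y → chainsModBoundaries A Y := fun a => t₀ (ν a) + cls A (ℓ a)
  have ht : ∀ (a b : Y) (p : Path.Homotopic.Quotient a b), cls A p + t a - t b ∈ T := by
    intro a b p
    have := h' (ν a) (ν b) (((ℓ a).trans p).trans (ℓ b).symm)
    rw [cls_trans, cls_trans, cls_symm] at this
    convert this using 1
    simp only [t]
    abel
  -- The corrections become a linear map on 0-chains. Then `z - L (bdry z)` lies in `T` for path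
  -- classes, hence for every `z`; a cycle has no correction and lies in `T` itself.
  obtain ⟨L, hL⟩ := exists_linearMap_pointChain A t
  have hz : ∀ z : chainsModBoundaries A Y, z - L (bdry A Y z) ∈ T := by
    intro z
    have hz : z ∈ Submodule.span A
        {z | ∃ (a b : Y) (p : Path.Homotopic.Quotient a b), z = cls A p} := by
      rw [span_cls]; trivial
    induction hz using Submodule.span_induction with
    | mem z hz =>
      obtain ⟨a, b, p, rfl⟩ := hz
      rw [bdry_cls, map_sub, hL, hL]
      convert ht a b p using 1
      abel
    | zero => simp
    | add x y _ _ hx hy =>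
      convert T.add_mem hx hy using 1
      rw [map_add, map_add]
      abel
    | smul c x _ hx =>
      convert T.smul_mem c hx using 1
      rw [map_smul, map_smul, smul_sub]
  refine eq_top_iff.2 fun z _ => ?_
  have h1 := hz (homologyIncl A Y z)
  rw [bdry_homologyIncl, map_zero, sub_zero] at h1
  obtain ⟨z', hz', he⟩ := h1
  rwa [← homologyIncl_injective A he]

theorem joined_out (a : Y) : Joined (Quotient.out (ZerothHomotopy.mk a)) a :=
  Quotient.exact (Quotient.out_eq (ZerothHomotopy.mk a))

/-- Correction terms at the points `w j` for which the corrected classes of paths are cycles. -/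
theorem exists_homology_class {t₀ : J → chainsModBoundaries A Y}
    (ht₀ : ∀ j, bdry A Y (t₀ j) =
      pointChain A (w j) - pointChain A (Quotient.out (ZerothHomotopy.mk (w j))))
    {i j : J} (p : Path.Homotopic.Quotient (w i) (w j)) :
    ∃ z, homologyIncl A Y z = t₀ i + cls A p - t₀ j := by
  refine exists_homologyIncl_eq A ?_
  have : ZerothHomotopy.mk (w i) = ZerothHomotopy.mk (w j) :=
    Quotient.sound (joined_of_quotient p)
  rw [map_sub, map_add, ht₀, ht₀, bdry_cls, this]
  abel

theorem Generates.mgs_lt_top [Finite J] {G : ∀ i j, Set (Path.Homotopic.Quotient (w i) (w j))}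
    (hG : Generates w G) (hw : Function.Injective w) (hjoin : ∀ a, ∃ j, Joined (w j) a)
    (hfin : ∀ i j, (G i j).Finite) (ρ : Y) : mgs (FundamentalGroup Y ρ) < ⊤ := by
  let τ₀ : ∀ j, Joined ρ (w j) → Path.Homotopic.Quotient ρ (w j) := fun j h =>
    Path.Homotopic.Quotient.mk h.somePath
  let S : Set (FundamentalGroup Y ρ) := ⋃ (i : J) (j : J) (hi : Joined ρ (w i))
    (hj : Joined ρ (w j)), (fun p => loopOf (τ₀ i hi) p (τ₀ j hj)) '' G i j
  have hS : S.Finite := finite_iUnion fun i => finite_iUnion fun j => finite_iUnion fun hi =>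
    finite_iUnion fun hj => (hfin i j).image _
  obtain ⟨j₀, hj₀⟩ := hjoin ρ
  have htop := hG.eq_top hw τ₀ (Subgroup.closure S) (fun i j hi hj p hp =>
    Subgroup.subset_closure (mem_iUnion.2 ⟨i, mem_iUnion.2 ⟨j, mem_iUnion.2 ⟨hi,
      mem_iUnion.2 ⟨hj, p, hp, rfl⟩⟩⟩⟩)) hj₀.symm
  exact (mgs_le htop).trans_lt hS.encard_lt_top

theorem Generates.mgsModule_lt_top [Finite J]
    {G : ∀ i j, Set (Path.Homotopic.Quotient (w i) (w j))}
    (hG : Generates w G) (hw : Function.Injective w) (hjoin : ∀ a, ∃ j, Joined (w j) a)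
    (hfin : ∀ i j, (G i j).Finite) : mgsModule A (H1 A Y) < ⊤ := by
  let t₀ : J → chainsModBoundaries A Y := fun j =>
    cls A (Path.Homotopic.Quotient.mk (joined_out (w j)).somePath)
  have ht₀ : ∀ j, bdry A Y (t₀ j) =
      pointChain A (w j) - pointChain A (Quotient.out (ZerothHomotopy.mk (w j))) :=
    fun j => bdry_cls A _
  let Z : Set (chainsModBoundaries A Y) :=
    ⋃ (i : J) (j : J), (fun p => t₀ i + cls A p - t₀ j) '' G i j
  have hZ : Z.Finite := finite_iUnion fun i => finite_iUnion fun j => (hfin i j).image _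
  let W : Set (H1 A Y) := homologyIncl A Y ⁻¹' Z
  have hW : W.Finite := hZ.preimage (homologyIncl_injective A).injOn
  refine (mgsModule_le (hG.span_eq_top A hw hjoin t₀ W fun i j p hp => ?_)).trans_lt
    hW.encard_lt_top
  obtain ⟨z, hz⟩ := exists_homology_class A ht₀ p
  refine ⟨z, Submodule.subset_span ?_, hz⟩
  change homologyIncl A Y z ∈ Z
  rw [hz]
  exact mem_iUnion.2 ⟨i, mem_iUnion.2 ⟨j, p, hp, rfl⟩⟩

end Generation

end RipsMin

end

noncomputable section

namespace RipsMin

open Set Topology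

/-! ### Finiteness of the invariants of X -/

section Finiteness

theorem mk_eq_mk_of_isSimplyConnected {Y : Type*} [TopologicalSpace Y] {s : Set Y}
    (hs : IsSimplyConnected s) {a b : Y} (p q : Path a b) (hp : ∀ t, p t ∈ s) (hq : ∀ t, q t ∈ s) :
    Path.Homotopic.Quotient.mk p = Path.Homotopic.Quotient.mk q := by
  have := hs.simplyConnectedSpace
  have ha : a ∈ s := by simpa using hp 0
  have hb : b ∈ s := by simpa using hp 1
  let p' : Path (⟨a, ha⟩ : s) ⟨b, hb⟩ :=
    ⟨⟨fun t => ⟨p t, hp t⟩, by fun_prop⟩, by simp, by simp⟩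
  let q' : Path (⟨a, ha⟩ : s) ⟨b, hb⟩ :=
    ⟨⟨fun t => ⟨q t, hq t⟩, by fun_prop⟩, by simp, by simp⟩
  have h := (SimplyConnectedSpace.paths_homotopic p' q').map ⟨Subtype.val, continuous_subtype_val⟩
  exact Path.Homotopic.Quotient.eq.2 h

variable {X : Type u} [MetricSpace X] [CompactSpace X]

/-- The paths between the points of a finite net are generated by finitely many classes. -/
theorem exists_finite_generates {R : ℝ} (hR : 0 < R) (hX : SimplyConnectedUpTo X R) :
    ∃ (T : Set X) (G : ∀ i j : T, Set (Path.Homotopic.Quotient (i : X) (j : X))), T.Finite ∧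
      (∀ a, ∃ j : T, Joined (j : X) a) ∧ (∀ i j, (G i j).Finite) ∧
      Generates (fun i : T => (i : X)) G := by
  -- If the `ε`-balls around `i` and `j` meet, the second lies in the `3 * ε`-ball around `i`, which
  -- is still simply connected.
  obtain ⟨ε, hε, hεR⟩ : ∃ ε, 0 < ε ∧ 3 * ε < R := ⟨R / 4, by linarith, by linarith⟩
  obtain ⟨T, -, hTf, hT⟩ := finite_cover_balls_of_compact (isCompact_univ (X := X)) hε
  have hcov : ∀ a, ∃ j : T, a ∈ Metric.ball (j : X) ε := fun a => by
    obtain ⟨j, hj, ha⟩ := mem_iUnion₂.1 (hT (mem_univ a))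
    exact ⟨⟨j, hj⟩, ha⟩
  have hjoin : ∀ i : X, ∀ p ∈ Metric.ball i ε, JoinedIn (Metric.ball i ε) i p := fun i p hp =>
    (hX i ε hε (by linarith)).isPathConnected.joinedIn _ (Metric.mem_ball_self hε) _ hp
  refine ⟨T, fun i j => {p | ∃ α : Path (i : X) (j : X),
    (∀ t, α t ∈ Metric.ball (i : X) (3 * ε)) ∧ p = Path.Homotopic.Quotient.mk α}, hTf, ?_, ?_, ?_⟩
  · intro a
    obtain ⟨j, hj⟩ := hcov a
    exact ⟨j, (hjoin j a hj).joined⟩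
  · intro i j
    -- Simple connectivity of the `3 * ε`-ball leaves at most one class for each pair of net points.
    refine Set.Subsingleton.finite ?_
    rintro _ ⟨α, hα, rfl⟩ _ ⟨β, hβ, rfl⟩
    exact mk_eq_mk_of_isSimplyConnected (hX i (3 * ε) (by linarith) hεR) α β hα hβ
  · intro S hS i j p
    refine S.mem_of_openCover (fun i : T => Metric.ball (i : X) ε) (fun i => Metric.isOpen_ball)
      hcov (fun i : T => (i : X)) (fun i => Metric.mem_ball_self hε) (fun i => hjoin i) ?_ i j p
    intro i j p α β hα hβ
    rw [← Path.Homotopic.Quotient.mk_trans]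
    refine hS i j _ ⟨α.trans β, fun t => ?_, rfl⟩
    have hmem : α.trans β t ∈ range α ∪ range β := by
      rw [← Path.trans_range]
      exact mem_range_self t
    have hpi : dist p i < ε := by simpa using hα 1
    have hpj : dist p j < ε := by simpa using hβ 0
    rw [Metric.mem_ball]
    rcases hmem with ⟨s, hs⟩ | ⟨s, hs⟩
    · rw [← hs]
      have := Metric.mem_ball.1 (hα s)
      linarith
    · rw [← hs]
      have h1 := Metric.mem_ball.1 (hβ s)
      have h2 := dist_triangle (β s) j i
      have h3 := dist_triangle (j : X) p i
      rw [dist_comm (j : X) p] at h3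
      linarith

theorem finite_zerothHomotopy {R : ℝ} (hR : 0 < R) (hX : SimplyConnectedUpTo X R) :
    Finite (ZerothHomotopy X) := by
  obtain ⟨T, G, hT, hjoin, -, -⟩ := exists_finite_generates hR hX
  have := hT.to_subtype
  refine Finite.of_surjective (fun j : T => ZerothHomotopy.mk (j : X)) fun c => ?_
  obtain ⟨a, rfl⟩ := ZerothHomotopy.mk_surjective c
  obtain ⟨j, hj⟩ := hjoin a
  exact ⟨j, Quotient.sound hj⟩

theorem mgs_fundamentalGroup_lt_top {R : ℝ} (hR : 0 < R) (hX : SimplyConnectedUpTo X R) (x : X) :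
    mgs (FundamentalGroup X x) < ⊤ := by
  obtain ⟨T, G, hT, hjoin, hfin, hG⟩ := exists_finite_generates hR hX
  have := hT.to_subtype
  exact hG.mgs_lt_top Subtype.val_injective hjoin hfin x

theorem mgsModule_H1_lt_top {R : ℝ} (hR : 0 < R) (hX : SimplyConnectedUpTo X R)
    (A : Type v) [CommRing A] : mgsModule A (H1 A X) < ⊤ := by
  obtain ⟨T, G, hT, hjoin, hfin, hG⟩ := exists_finite_generates hR hX
  have := hT.to_subtype
  exact hG.mgsModule_lt_top A Subtype.val_injective hjoin hfin

theorem MGS_lt_top {R : ℝ} (hR : 0 < R) (hX : SimplyConnectedUpTo X R) : MGS X < ⊤ := by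
  have := finite_zerothHomotopy hR hX
  have := Fintype.ofFinite (ZerothHomotopy X)
  rw [MGS, tsum_fintype, ENat.sum_lt_top]
  exact fun j _ => mgs_fundamentalGroup_lt_top hR hX _

end Finiteness

/-! ### Counting the minimal edges -/

section MinEdges

variable (X : Type u) [MetricSpace X]

/-- The edges of length less than `r` at which the distance function has a positive local
minimum. -/
def allMinEdges (hmin : (LocMin X).Finite) (r : ℝ) : Set (Sym2 X) :=
  ⋃ c ∈ hmin.toFinset.filter (fun c => 0 < c ∧ c < r), minEdges X c

theorem encard_allMinEdges_le (hmin : (LocMin X).Finite) (r : ℝ) :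
    (allMinEdges X hmin r).encard ≤ numMinEdges X hmin r :=
  Finset.set_encard_biUnion_le _ _

theorem mem_allMinEdges (hmin : (LocMin X).Finite) {r : ℝ} {x y : X} (h : dist x y < r)
    (h0 : 0 < dist x y) (hm : (x, y) ∈ minPairs X (dist x y)) :
    s(x, y) ∈ allMinEdges X hmin r := by
  refine mem_iUnion₂.2 ⟨dist x y, ?_, (x, y), hm, rfl⟩
  rw [Finset.mem_filter, Set.Finite.mem_toFinset]
  exact ⟨⟨_, hm⟩, h0, h⟩

theorem numMinEdges_lt_top (hmin : (LocMin X).Finite)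
    (hfin : ∀ c : ℝ, 0 < c → (minPairs X c).Finite) (r : ℝ) : numMinEdges X hmin r < ⊤ := by
  rw [numMinEdges, ENat.sum_lt_top]
  intro c hc
  exact ((hfin c (Finset.mem_filter.1 hc).2.1).image _).encard_lt_top

end MinEdges

/-! ### Generators of the paths in the Rips complex -/

section RipsGeneration

variable {X : Type u} [MetricSpace X] {r : ℝ} (φ : FineMap X r)

/-- The classes of paths in the Rips complex which come from `X` or from an edge at which the
distance function has a positive local minimum. -/
def FineMap.gens (hr : 0 < r) (x y : X) :
    Set (Path.Homotopic.Quotient (ripsPoint X hr x) (ripsPoint X hr y)) :=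
  range (fun p : Path.Homotopic.Quotient x y => φ.push hr p) ∪
    {q | ∃ h : dist x y < r, 0 < dist x y ∧ (x, y) ∈ minPairs X (dist x y) ∧ q = edge hr x y h}

theorem FineMap.generates [CompactSpace X] (hr : 0 < r) {R : ℝ} (hR : 0 < R)
    (hX : SimplyConnectedUpTo X R) :
    Generates (ripsPoint X hr) (φ.gens hr) := by
  intro S hS x y p
  refine φ.mem_of_push_of_minPairs hr hR hX S (fun x y p => hS x y _ (Or.inl ⟨p, rfl⟩))
    (fun x y h h0 hm => hS x y _ (Or.inr ⟨h, h0, hm, rfl⟩)) x y p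

theorem ripsPoint_injective (hr : 0 < r) : Function.Injective (ripsPoint X hr) := by
  intro x y h
  have h1 := congrArg (fun p : RipsSpace X r => p.1.support) h
  simp only [support_ripsPoint] at h1
  simpa using h1

theorem exists_joined_ripsPoint (hr : 0 < r) (p : RipsSpace X r) :
    ∃ x, Joined (ripsPoint X hr x) p := by
  obtain ⟨x, hx⟩ := exists_mem_openStar p
  exact ⟨x, ⟨Realization.line _ _ (exists_face_of_mem_openStar' _ hx)⟩⟩

theorem FineMap.joined_map (hr : 0 < r) (x : X) : Joined (ripsPoint X hr x) (φ.map x) :=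
  joined_of_quotient (φ.lam hr x)

theorem FineMap.joined_map_of_mk_eq {x y : X} (h : ZerothHomotopy.mk x = ZerothHomotopy.mk y) :
    Joined (φ.map x) (φ.map y) := by
  have h1 : Joined x y := Quotient.exact h
  exact ⟨h1.somePath.map φ.map.continuous⟩

end RipsGeneration

end RipsMin

end

noncomputable section

namespace RipsMin

open Set Topology

/-! ### The bound for first homology -/

section Homology

variable {X : Type u} [MetricSpace X] [CompactSpace X] {r : ℝ}

/-- The first homology of the Rips complex needs at most as many generators as that of `X` and one
more for every edge at which the distance function has a positive local minimum. -/
theorem mgsModule_H1_rips_le (A : Type v) [CommRing A] (hr : 0 < r) {R : ℝ} (hR : 0 < R)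
    (hX : SimplyConnectedUpTo X R) (hmin : (LocMin X).Finite) :
    mgsModule A (H1 A (RipsSpace X r)) ≤ mgsModule A (H1 A X) + numMinEdges X hmin r := by
  obtain ⟨φ⟩ := exists_fineMap (X := X) hr
  obtain ⟨f, g, hfg, hg⟩ := exists_homologyMap A φ.map
  let rep : X → X := fun x => Quotient.out (ZerothHomotopy.mk x)
  let s : ∀ x, Path.Homotopic.Quotient (rep x) x := fun x =>
    Path.Homotopic.Quotient.mk (joined_out x).somePath
  let a : ZerothHomotopy X → chainsModBoundaries A (RipsSpace X r) := fun i =>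
    cls A (Path.Homotopic.Quotient.mk (joined_out (φ.map (Quotient.out i))).somePath)
  -- With this choice the segments `φ.lam` and the terms `a` cancel for a pushed path `q`, leaving
  -- `g` applied to a cycle of `X`, so that its class is in the image of `f`.
  let t₀ : X → chainsModBoundaries A (RipsSpace X r) := fun x =>
    a (ZerothHomotopy.mk x) + g (cls A (s x)) - cls A (φ.lam hr x)
  have ht₀ : ∀ x, bdry A _ (t₀ x) = pointChain A (ripsPoint X hr x) -
      pointChain A (Quotient.out (ZerothHomotopy.mk (ripsPoint X hr x))) := by
    intro x
    have e : ZerothHomotopy.mk (φ.map (rep x)) = ZerothHomotopy.mk (ripsPoint X hr x) :=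
      Quotient.sound ((φ.joined_map_of_mk_eq (Quotient.out_eq (ZerothHomotopy.mk x))).trans
        (φ.joined_map hr x).symm)
    have e2 : bdry A _ (a (ZerothHomotopy.mk x)) = pointChain A (φ.map (rep x)) -
        pointChain A (Quotient.out (ZerothHomotopy.mk (φ.map (rep x)))) := bdry_cls A _
    rw [map_sub, map_add, e2, hg, bdry_cls, bdry_cls, e]
    abel
  obtain ⟨S, hS, hSc⟩ := exists_encard_eq_mgsModule A (H1 A X)
  -- One generator serves both orientations of an edge, since reversal changes the sign of the
  -- corrected class.
  have hedge : ∀ e : Sym2 X, ∃ z : H1 A (RipsSpace X r), ∀ (x y : X) (h : dist x y < r),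
      s(x, y) = e → homologyIncl A _ z = t₀ x + cls A (edge hr x y h) - t₀ y ∨
        homologyIncl A _ (-z) = t₀ x + cls A (edge hr x y h) - t₀ y := by
    intro e
    induction e using Sym2.ind with | _ x y =>
    by_cases h : dist x y < r
    · obtain ⟨z, hz⟩ := exists_homology_class A ht₀ (edge hr x y h)
      refine ⟨z, fun x' y' h' he => ?_⟩
      rw [Sym2.eq_iff] at he
      rcases he with ⟨rfl, rfl⟩ | ⟨rfl, rfl⟩
      · exact Or.inl hz
      · right
        rw [map_neg, hz, ← edge_symm hr h h', cls_symm]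
        abel
    · refine ⟨0, fun x' y' h' he => (h ?_).elim⟩
      rw [Sym2.eq_iff] at he
      rcases he with ⟨rfl, rfl⟩ | ⟨rfl, rfl⟩
      · exact h'
      · rwa [dist_comm]
  choose z hz using hedge
  let W : Set (H1 A (RipsSpace X r)) := f '' S ∪ z '' allMinEdges X hmin r
  have hspan := (φ.generates hr hR hX).span_eq_top A (ripsPoint_injective hr)
    (exists_joined_ripsPoint hr) t₀ W ?_
  · refine (mgsModule_le hspan).trans ((encard_union_le _ _).trans (add_le_add ?_ ?_))
    · exact (encard_image_le _ _).trans hSc.le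
    · exact (encard_image_le _ _).trans (encard_allMinEdges_le X hmin r)
  · intro x y p hp
    rcases hp with ⟨q, rfl⟩ | ⟨h, h0, hm, rfl⟩
    · have hxy : ZerothHomotopy.mk x = ZerothHomotopy.mk y :=
        Quotient.sound (joined_of_quotient q)
      obtain ⟨c, hc⟩ := exists_homology_class A (w := fun x : X => x)
        (t₀ := fun x => cls A (s x)) (fun x => bdry_cls A _) q
      refine ⟨f c, ?_, ?_⟩
      · have h1 : c ∈ Submodule.span A S := by rw [hS]; trivial
        have h2 := Submodule.mem_map_of_mem (f := f) h1
        rw [Submodule.map_span] at h2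
        exact Submodule.span_mono subset_union_left h2
      · rw [hfg, hc, map_sub, map_add]
        simp only [t₀, FineMap.push, cls_trans, cls_symm, hg, hxy]
        abel
    · have hmem : z s(x, y) ∈ Submodule.span A W := Submodule.subset_span
        (Or.inr ⟨_, mem_allMinEdges X hmin h h0 hm, rfl⟩)
      rcases hz s(x, y) x y h rfl with he | he
      · exact ⟨_, hmem, he⟩
      · exact ⟨_, Submodule.neg_mem _ hmem, he⟩

end Homology

/-! ### The bound for fundamental groups -/

section FundamentalGroups

variable {X : Type u} [MetricSpace X] {r : ℝ}

/-- The homomorphism on fundamental groups induced by a continuous map and a change of base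
point. -/
def pushHom {Y Z : Type*} [TopologicalSpace Y] [TopologicalSpace Z] (f : C(Y, Z)) {y : Y} {ρ : Z}
    (a : Path.Homotopic.Quotient ρ (f y)) : FundamentalGroup Y y →* FundamentalGroup Z ρ where
  toFun g := loopOf a ((FundamentalGroup.toPath g).map f) a
  map_one' := loopOf_refl a
  map_mul' g h := by
    rw [← loopOf_trans]
    congr 1
    exact (FundamentalGroupoid.map f).map_comp h g

theorem quotient_map_trans {Y Z : Type*} [TopologicalSpace Y] [TopologicalSpace Z] (f : C(Y, Z))
    {a b c : Y} (p : Path.Homotopic.Quotient a b) (q : Path.Homotopic.Quotient b c) :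
    (p.trans q).map f = (p.map f).trans (q.map f) :=
  (FundamentalGroupoid.map f).map_comp (X := ⟨a⟩) (Y := ⟨b⟩) (Z := ⟨c⟩) p q

theorem quotient_map_symm {Y Z : Type*} [TopologicalSpace Y] [TopologicalSpace Z] (f : C(Y, Z))
    {a b : Y} (p : Path.Homotopic.Quotient a b) : p.symm.map f = (p.map f).symm := by
  induction p using Path.Homotopic.Quotient.ind with | mk p => rfl

theorem quotient_symm_trans {Y : Type*} [TopologicalSpace Y] {a b c : Y}
    (p : Path.Homotopic.Quotient a b) (q : Path.Homotopic.Quotient b c) :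
    (p.trans q).symm = q.symm.trans p.symm := by
  induction p using Path.Homotopic.Quotient.ind with | mk p =>
  induction q using Path.Homotopic.Quotient.ind with | mk q =>
  exact congrArg Path.Homotopic.Quotient.mk (Path.trans_symm p q)

theorem quotient_symm_symm {Y : Type*} [TopologicalSpace Y] {a b : Y}
    (p : Path.Homotopic.Quotient a b) : p.symm.symm = p := by
  induction p using Path.Homotopic.Quotient.ind with | mk p =>
  exact congrArg Path.Homotopic.Quotient.mk (Path.symm_symm p)

theorem quotient_symm_trans_cancel {Y : Type*} [TopologicalSpace Y] {a b c : Y}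
    (p : Path.Homotopic.Quotient a b) (q : Path.Homotopic.Quotient b c) :
    p.symm.trans (p.trans q) = q := by
  rw [← Path.Homotopic.Quotient.trans_assoc, Path.Homotopic.Quotient.symm_trans,
    Path.Homotopic.Quotient.refl_trans]

/-- With connecting paths that run through the image of `X` and end with the reversed segments
`φ.lam`, these segments cancel against those in `φ.push`. Pushed paths thus give elements in the
image of the fundamental group of a component of `X`. -/
theorem FineMap.loopOf_push (φ : FineMap X r) (hr : 0 < r) {x y b : X} {ρ : RipsSpace X r}
    (a : Path.Homotopic.Quotient ρ (φ.map b)) (s : Path.Homotopic.Quotient b x)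
    (t : Path.Homotopic.Quotient b y) (p : Path.Homotopic.Quotient x y) :
    loopOf ((a.trans (s.map φ.map)).trans (φ.lam hr x).symm) (φ.push hr p)
      ((a.trans (t.map φ.map)).trans (φ.lam hr y).symm) = pushHom φ.map a (loopOf s p t) := by
  simp only [pushHom, loopOf, FineMap.push, MonoidHom.coe_mk, OneHom.coe_mk, quotient_map_trans,
    quotient_map_symm, quotient_symm_trans, quotient_symm_symm, Path.Homotopic.Quotient.trans_assoc,
    quotient_symm_trans_cancel]

/-- The component of the Rips complex in which an edge lies. -/
def edgeComponent (hr : 0 < r) (e : Sym2 X) : ZerothHomotopy (RipsSpace X r) :=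
  ZerothHomotopy.mk (ripsPoint X hr (Quot.out e).1)

/-- The end point picked by `Quot.out` does not matter, since the edge joins the two. -/
theorem edgeComponent_eq (hr : 0 < r) {x y : X} (h : dist x y < r) :
    edgeComponent hr s(x, y) = ZerothHomotopy.mk (ripsPoint X hr x) := by
  have he : s((Quot.out s(x, y)).1, (Quot.out s(x, y)).2) = s(x, y) := Quot.out_eq s(x, y)
  rw [Sym2.eq_iff] at he
  rw [edgeComponent]
  rcases he with ⟨h1, -⟩ | ⟨h1, -⟩
  · rw [h1]
  · rw [h1]
    exact (Quotient.sound (joined_of_quotient (edge hr x y h))).symm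

/-- The component of the Rips complex in which a component of `X` lies. -/
def FineMap.component (φ : FineMap X r) (i : ZerothHomotopy X) : ZerothHomotopy (RipsSpace X r) :=
  ZerothHomotopy.mk (φ.map (Quotient.out i))

theorem FineMap.component_mk (φ : FineMap X r) (hr : 0 < r) (x : X) :
    φ.component (ZerothHomotopy.mk x) = ZerothHomotopy.mk (ripsPoint X hr x) :=
  Quotient.sound ((φ.joined_map_of_mk_eq (Quotient.out_eq (ZerothHomotopy.mk x))).trans
    (φ.joined_map hr x).symm)

theorem FineMap.component_surjective (φ : FineMap X r) (hr : 0 < r) :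
    Function.Surjective φ.component := by
  intro j
  obtain ⟨p, rfl⟩ := ZerothHomotopy.mk_surjective j
  obtain ⟨x, hx⟩ := exists_joined_ripsPoint hr p
  exact ⟨ZerothHomotopy.mk x, (φ.component_mk hr x).trans (Quotient.sound hx)⟩

/-- The fundamental group of a component of the Rips complex needs at most as many generators as
those of the components of `X` lying in it and one more for every edge in it at which the distance
function has a positive local minimum. -/
theorem mgs_component_le [CompactSpace X] (φ : FineMap X r) (hr : 0 < r) {R : ℝ} (hR : 0 < R)
    (hX : SimplyConnectedUpTo X R) (hmin : (LocMin X).Finite) [Fintype (ZerothHomotopy X)]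
    [DecidableEq (ZerothHomotopy (RipsSpace X r))] (j : ZerothHomotopy (RipsSpace X r)) :
    mgs (FundamentalGroup (RipsSpace X r) (Quotient.out j)) ≤
      ∑ i with φ.component i = j, mgs (FundamentalGroup X (Quotient.out i)) +
        (allMinEdges X hmin r ∩ {e | edgeComponent hr e = j}).encard := by
  set ρ : RipsSpace X r := Quotient.out j with hρ
  have hρj : ∀ {p : RipsSpace X r}, Joined ρ p ↔ ZerothHomotopy.mk p = j := by
    intro p
    constructor
    · intro h
      exact (Quotient.sound h.symm).trans (Quotient.out_eq j)
    · rintro rfl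
      exact joined_out p
  let s : ∀ (i : ZerothHomotopy X) (x : X), ZerothHomotopy.mk x = i →
      Path.Homotopic.Quotient (Quotient.out i) x := fun i x h =>
    Path.Homotopic.Quotient.mk (Joined.somePath (Quotient.exact ((Quotient.out_eq i).trans h.symm)))
  let a : ∀ i : ZerothHomotopy X, φ.component i = j →
      Path.Homotopic.Quotient ρ (φ.map (Quotient.out i)) := fun i h =>
    Path.Homotopic.Quotient.mk (hρj.2 h).somePath
  let τ : ∀ x, Joined ρ (ripsPoint X hr x) → Path.Homotopic.Quotient ρ (ripsPoint X hr x) :=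
    fun x h => ((a _ ((φ.component_mk hr x).trans (hρj.1 h))).trans
      ((s _ x rfl).map φ.map)).trans (φ.lam hr x).symm
  -- Freeing the component index from `x` lets two points of one component of `X` share the same
  -- base point and the same path `a`.
  have hτ : ∀ x h i (hi : ZerothHomotopy.mk x = i) (hij : φ.component i = j),
      τ x h = ((a i hij).trans ((s i x hi).map φ.map)).trans (φ.lam hr x).symm := by
    intro x h i hi hij
    subst hi
    rfl
  choose S hS hSc using fun i : ZerothHomotopy X =>
    exists_encard_eq_mgs (FundamentalGroup X (Quotient.out i))
  have hedge : ∀ e : Sym2 X, ∃ z : FundamentalGroup (RipsSpace X r) ρ,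
      ∀ (x y : X) (h : dist x y < r) (hx : Joined ρ (ripsPoint X hr x))
        (hy : Joined ρ (ripsPoint X hr y)), s(x, y) = e →
        loopOf (τ x hx) (edge hr x y h) (τ y hy) = z ∨
        loopOf (τ x hx) (edge hr x y h) (τ y hy) = z⁻¹ := by
    intro e
    induction e using Sym2.ind with | _ x y =>
    by_cases hc : ∃ (_ : dist x y < r) (_ : Joined ρ (ripsPoint X hr x)),
        Joined ρ (ripsPoint X hr y)
    · obtain ⟨h, hx, hy⟩ := hc
      refine ⟨loopOf (τ x hx) (edge hr x y h) (τ y hy), fun x' y' h' hx' hy' he => ?_⟩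
      rw [Sym2.eq_iff] at he
      rcases he with ⟨rfl, rfl⟩ | ⟨rfl, rfl⟩
      · exact Or.inl rfl
      · right
        rw [← edge_symm hr h h', loopOf_symm]
    · refine ⟨1, fun x' y' h' hx' hy' he => (hc ?_).elim⟩
      rw [Sym2.eq_iff] at he
      rcases he with ⟨rfl, rfl⟩ | ⟨rfl, rfl⟩
      · exact ⟨h', hx', hy'⟩
      · exact ⟨by rwa [dist_comm], hy', hx'⟩
  choose z hz using hedge
  -- The homomorphism needs a proof that the component lies over `j`; off this fibre `B i` is empty.
  let B : ZerothHomotopy X → Set (FundamentalGroup (RipsSpace X r) ρ) := fun i =>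
    {g | ∃ hij : φ.component i = j, g ∈ pushHom φ.map (a i hij) '' S i}
  let W : Set (FundamentalGroup (RipsSpace X r) ρ) :=
    (⋃ i ∈ Finset.univ.filter (fun i => φ.component i = j), B i) ∪
      z '' (allMinEdges X hmin r ∩ {e | edgeComponent hr e = j})
  obtain ⟨x₀, hx₀⟩ := exists_joined_ripsPoint hr ρ
  have htop := (φ.generates hr hR hX).eq_top (ripsPoint_injective hr) τ (Subgroup.closure W) ?_
    hx₀.symm
  · refine (mgs_le htop).trans ((encard_union_le _ _).trans (add_le_add ?_ (encard_image_le _ _)))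
    refine (Finset.set_encard_biUnion_le _ _).trans (Finset.sum_le_sum fun i hi => ?_)
    rw [← hSc i]
    have hij := (Finset.mem_filter.1 hi).2
    refine le_trans (encard_le_encard ?_) (encard_image_le (pushHom φ.map (a i hij)) (S i))
    rintro g ⟨_, hg⟩
    exact hg
  · intro x y hx hy p hp
    rcases hp with ⟨q, rfl⟩ | ⟨h, h0, hm, rfl⟩
    · have hxy : ZerothHomotopy.mk y = ZerothHomotopy.mk x :=
        (Quotient.sound (joined_of_quotient q)).symm
      have hij : φ.component (ZerothHomotopy.mk x) = j := (φ.component_mk hr x).trans (hρj.1 hx)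
      simp only
      rw [hτ x hx _ rfl hij, hτ y hy _ hxy hij, φ.loopOf_push]
      have hle : (⊤ : Subgroup (FundamentalGroup X (Quotient.out (ZerothHomotopy.mk x)))) ≤
          (Subgroup.closure W).comap (pushHom φ.map (a _ hij)) := by
        rw [← hS, Subgroup.closure_le]
        intro g hg
        refine Subgroup.subset_closure (Or.inl (mem_iUnion₂.2 ⟨ZerothHomotopy.mk x, ?_, hij, g,
          hg, rfl⟩))
        exact Finset.mem_filter.2 ⟨Finset.mem_univ _, hij⟩
      exact hle trivial
    · have hmem : z s(x, y) ∈ Subgroup.closure W := Subgroup.subset_closure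
        (Or.inr ⟨_, ⟨mem_allMinEdges X hmin h h0 hm,
          (edgeComponent_eq hr h).trans (hρj.1 hx)⟩, rfl⟩)
      rcases hz s(x, y) x y h hx hy rfl with he | he
      · rw [he]; exact hmem
      · rw [he]; exact Subgroup.inv_mem _ hmem

theorem MGS_rips_le [CompactSpace X] (hr : 0 < r) {R : ℝ} (hR : 0 < R)
    (hX : SimplyConnectedUpTo X R) (hmin : (LocMin X).Finite) :
    MGS (RipsSpace X r) ≤ MGS X + numMinEdges X hmin r := by
  classical
  obtain ⟨φ⟩ := exists_fineMap (X := X) hr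
  have := finite_zerothHomotopy hR hX
  have := Finite.of_surjective _ (φ.component_surjective hr)
  have := Fintype.ofFinite (ZerothHomotopy X)
  have := Fintype.ofFinite (ZerothHomotopy (RipsSpace X r))
  rw [MGS, MGS, tsum_fintype, tsum_fintype]
  refine (Finset.sum_le_sum fun j _ => mgs_component_le φ hr hR hX hmin j).trans ?_
  rw [Finset.sum_add_distrib]
  -- Each component of `X` lies over exactly one `j`, and the edge sets for different `j` are
  -- disjoint, so nothing is counted twice.
  refine add_le_add (Finset.sum_fiberwise Finset.univ φ.component
    fun i => mgs (FundamentalGroup X (Quotient.out i))).le (le_trans ?_ (encard_allMinEdges_le X hmin r))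
  rw [← finsum_eq_sum_of_fintype, ← encard_iUnion_of_finite]
  · exact encard_le_encard (iUnion_subset fun j => inter_subset_left)
  · intro j k hjk
    refine Set.disjoint_left.2 fun e he he' => hjk ?_
    exact he.2.symm.trans he'.2

theorem mgs_le_MGS {Y : Type u} [TopologicalSpace Y] [Finite (ZerothHomotopy Y)] (y : Y) :
    mgs (FundamentalGroup Y y) ≤ MGS Y := by
  have := Fintype.ofFinite (ZerothHomotopy Y)
  rw [MGS, tsum_fintype, ← mgs_fundamentalGroup_eq (joined_out y)]
  exact Finset.single_le_sum (f := fun j : ZerothHomotopy Y =>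
    mgs (FundamentalGroup Y (Quotient.out j))) (fun _ _ => zero_le) (Finset.mem_univ _)

theorem finite_zerothHomotopy_rips [CompactSpace X] (hr : 0 < r) {R : ℝ} (hR : 0 < R)
    (hX : SimplyConnectedUpTo X R) : Finite (ZerothHomotopy (RipsSpace X r)) := by
  obtain ⟨φ⟩ := exists_fineMap (X := X) hr
  have := finite_zerothHomotopy hR hX
  exact Finite.of_surjective _ (φ.component_surjective hr)

end FundamentalGroups

end RipsMin

end

theorem theorem4p13 {X : Type u} [MetricSpace X] [CompactSpace X] (x₀ : X)
    (A : Type v) [CommRing A]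
    {R : ℝ} (hR : 0 < R) (hX : RipsMin.SimplyConnectedUpTo X R)
    (hmin : (RipsMin.LocMin X).Finite)
    (hfin : ∀ c : ℝ, 0 < c → (RipsMin.minPairs X c).Finite)
    {r : ℝ} (hr : 0 < r) :
    (RipsMin.mgsModule A (RipsMin.H1 A (RipsMin.RipsSpace X r)) ≤
        RipsMin.mgsModule A (RipsMin.H1 A X) + RipsMin.numMinEdges X hmin r ∧
      RipsMin.mgsModule A (RipsMin.H1 A X) + RipsMin.numMinEdges X hmin r < ⊤) ∧
    (RipsMin.MGS (RipsMin.RipsSpace X r) ≤ RipsMin.MGS X + RipsMin.numMinEdges X hmin r ∧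
      RipsMin.MGS X + RipsMin.numMinEdges X hmin r < ⊤) ∧
    RipsMin.mgs (FundamentalGroup (RipsMin.RipsSpace X r) (RipsMin.ripsPoint X hr x₀)) ≤
      RipsMin.MGS X + RipsMin.numMinEdges X hmin r := by
  have hN := RipsMin.numMinEdges_lt_top X hmin hfin r
  have hM := RipsMin.MGS_rips_le hr hR hX hmin
  have := RipsMin.finite_zerothHomotopy_rips hr hR hX
  exact ⟨⟨RipsMin.mgsModule_H1_rips_le A hr hR hX hmin,
    ENat.add_lt_top.2 ⟨RipsMin.mgsModule_H1_lt_top hR hX A, hN⟩⟩,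
    ⟨hM, ENat.add_lt_top.2 ⟨RipsMin.MGS_lt_top hR hX, hN⟩⟩,
    (RipsMin.mgs_le_MGS _).trans hM⟩
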